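/- Let $\Sigma$ be a finite alphabet. A hyperproperty is a set $\mathbf S\subseteq\mathcal P(\Sigma^\omega)$. For $T\subseteq\Sigma^*$ and $T'\subseteq\Sigma^\omega$ write $T\le T'$ if every $t\in T$ is a prefix of some $t'\in T'$; $T$ is a bad prefix of $\mathbf S$ if $T'\notin\mathbf S$ for every $T'\ge T$. $\mathbf S$ is $k$-safety if every $T'\notin\mathbf S$ has a bad prefix $T\le T'$ with $|T|\le k$. For $k\ge 1$, a word $\sigma\in(\Sigma^k)^*$ represents the set $\mathrm{unzip}(\sigma)$ of its $k$ component traces. A language $L\subseteq(\Sigma^k)^*$ is a $k$-representation of $\mathbf S$ if all its words represent bad prefixes of $\mathbf S$ and, for all $T'\subseteq\Sigma^\omega$, $T'\notin\mathbf S$ iff $\mathrm{unzip}(\sigma)\le T'$ for some $\sigma\in L$. A finite automaton recognizing a $k$-representation of $\mathbf S$ is a $k$-bad-prefix automaton for $\mathbf S$, and $\mathbf S$ is regular if it has one for some $k\ge1$. A $k$-bad-prefix automaton is tight if it accepts a representation of every bad prefix that consists of at most $k$ traces of a common length; it is permutation-complete if, with a word $\sigma$, it accepts all words $\sigma'\in(\Sigma^k)^*$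 with $\mathrm{unzip}(\sigma')=\mathrm{unzip}(\sigma)$. A deterministic, tight, permutation-complete $k$-bad-prefix automaton for $\mathbf S$ is minimal if $\mathbf S$ has no bad-prefix automaton of arity less than $k$, and no deterministic (complete), tight, permutation-complete $k$-bad-prefix automaton for $\mathbf S$ has fewer states. A teacher for $\mathbf S$ answers membership queries (does $\sigma\in(\Sigma^{k'})^*$ represent a bad prefix of $\mathbf S$?) and equivalence queries (is the deterministic automaton $\mathcal A$ over $\Sigma^{k'}$ a $k'$-bad-prefix automaton for $\mathbf S$?). If the answer to an equivalence query is no, it provides a counterexample: a representation, of some arity $c$, of a bad prefix of which $\mathcal A$ accepts no representation, or a word accepted by $\mathcal A$ (then $c=k'$) that does not represent a bad prefix. Let $\kappa$ be the least arity of a bad-prefix automaton for $\mathbf S$. The teacher is minimal-adequate if its answers are correct and, for queried automata of arity at most $\kappa$, its counterexamples have arity at most $\kappa$ and are of minimal length among the counterexamples of arity at most $\kappa$. The algorithm $L^*_{Hyper}$ keeps an observation table over $\Sigma^{k'}$, with accessing sequences $S$, separating sequences $E$ and the membership answers for $(S\cup S\cdot\Sigma^{k'})\cdot E$; it starts with $k'=1$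 and $S=E=\{\varepsilon\}$. As in Angluin's $L^*$ it repairs the table until it is consistent and closed, and then makes an equivalence query with the automaton whose states are the rows of $S$. A counterexample of arity $c\le k'$ is extended to arity $k'$ by repeating its last component, and its prefixes are added to $S$. If $c>k'$, the words of $S$ and $E$ are first extended to arity $c$ in the same way, the table is filled again, and the learner continues with arity $c$. If the answer is yes, then for every $\varsigma:\{1,\dots,k'\}\to\{1,\dots,k'\}$ the algorithm searches, by breadth-first search in a product automaton, for a word that is rejected although the word obtained from it by permuting all its letters by $\varsigma$ is accepted. Such a word is treated as a further counterexample; if there is none, the algorithm stops and returns the automaton. Its running time is the number of elementary operations on letters, bits, states, list cells and array cells, including the writing of queries and the reading of answers, but not the work of the teacher. **Theorem.** For every finite alphabet $\Sigma$ there is a constant $C$ such that the following holds for every $k_0\ge1$, every regular $k_0$-safety hyperproperty $\mathbf S$ over $\Sigma$ and every minimal-adequate teacher for $\mathbf S$. $L^*_{Hyper}$ terminates and returns a minimal, deterministic, tight and permutation-complete bad-prefix automaton $\mathcal A$ for $\mathbf S$. Its arity $k$ satisfies $k\le k_0$, and the running time is at most $$C\,(n+m)^{C}\,(k+1)^{C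 k},$$ where $n$ is the number of states of $\mathcal A$ and $m$ is the length of the longest counterexample provided by the teacher ($0$ if there is none). So the running time is polynomial in $n$ and $m$ and exponential, $2^{O(k\log k)}$, in $k$. -/

import Mathlib

namespace HyperLearn

/-! ### Hyperproperties, bad prefixes and representations -/

/-- A hyperproperty over the alphabet `A`: a set of sets of infinite traces. -/
abbrev Hyperproperty (A : Type) := Set (Set (ℕ → A))

/-- The finite trace `t` is a prefix of the infinite trace `t'`. -/
def TracePrefix {A : Type} (t : List A) (t' : ℕ → A) : Prop :=
  ∀ (i : ℕ) (h : i < t.length), t[i] = t' i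

/-- `T ≤ T'`: every finite trace of `T` is a prefix of some infinite trace of `T'`. -/
def SetPrefix {A : Type} (T : Set (List A)) (T' : Set (ℕ → A)) : Prop :=
  ∀ t ∈ T, ∃ t' ∈ T', TracePrefix t t'

/-- The bad prefixes of `S`. -/
def bad {A : Type} (S : Hyperproperty A) : Set (Set (List A)) :=
  {T | ∀ T' : Set (ℕ → A), SetPrefix T T' → T' ∉ S}

/-- `S` is a `k`-safety hyperproperty: every violating set of traces has a bad prefix with at
most `k` elements. -/
def IsKSafety {A : Type} (S : Hyperproperty A) (k : ℕ) : Prop :=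
  ∀ T' : Set (ℕ → A), T' ∉ S → ∃ T ∈ bad S, T.encard ≤ k ∧ SetPrefix T T'

/-- Words over the alphabet `A ^ k`. Arities are positive. -/
abbrev Word (A : Type) (k : ℕ+) := List (Fin k → A)

/-- The set of the `k` finite traces of a word over `A ^ k`. -/
def unzip {A : Type} {k : ℕ+} (w : Word A k) : Set (List A) :=
  Set.range fun i : Fin k => w.map fun v => v i

/-- `L` is a `k`-representation of `S`: its words represent bad prefixes only, and the violating
sets of traces are exactly those with a bad prefix represented in `L`. -/
def IsRepresentation {A : Type} {k : ℕ+} (S : Hyperproperty A) (L : Language (Fin k → A)) : Prop :=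
  (∀ w ∈ L, unzip w ∈ bad S) ∧
    ∀ T' : Set (ℕ → A), T' ∉ S ↔ ∃ w ∈ L, SetPrefix (unzip w) T' ∧ unzip w ∈ bad S

/-- There is a `k`-bad-prefix automaton for `S`, i.e. a finite automaton recognizing a
`k`-representation of `S`. -/
def HasBadPrefixAutomaton {A : Type} (S : Hyperproperty A) (k : ℕ+) : Prop :=
  ∃ L : Language (Fin k → A), L.IsRegular ∧ IsRepresentation S L

/-- `S` is regular: one of its representations is a regular language. -/
def IsRegularHyper {A : Type} (S : Hyperproperty A) : Prop :=
  ∃ k : ℕ+, HasBadPrefixAutomaton S k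

/-- `k` is the minimal arity of a bad-prefix automaton for `S`. -/
def IsTargetArity {A : Type} (S : Hyperproperty A) (k : ℕ+) : Prop :=
  HasBadPrefixAutomaton S k ∧ ∀ k' < k, ¬ HasBadPrefixAutomaton S k'

/-- Tightness: a representation of every bad prefix with at most `k` traces is accepted. Only
sets of traces of a common length have representations. -/
def IsTight {A : Type} {k : ℕ+} (S : Hyperproperty A) (L : Language (Fin k → A)) : Prop :=
  ∀ T ∈ bad S, T.encard ≤ (k : ℕ) → (∃ l : ℕ, ∀ t ∈ T, t.length = l) → ∃ w ∈ L, unzip w = T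

/-- Permutation-completeness: with one representation of a set of traces, all of its
representations of the same arity are accepted. -/
def IsPermComplete {A : Type} {k : ℕ+} (L : Language (Fin k → A)) : Prop :=
  ∀ w ∈ L, ∀ w' : Word A k, unzip w' = unzip w → w' ∈ L

/-- The deterministic automaton `M` is a tight and permutation-complete `k`-bad-prefix automaton
for `S`. -/
structure IsTightPermCompleteBPA {A : Type} {k : ℕ+} {n : ℕ} (S : Hyperproperty A)
    (M : DFA (Fin k → A) (Fin n)) : Prop where
  representation : IsRepresentation S M.accepts
  tight : IsTight S M.accepts
  permComplete : IsPermComplete M.accepts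

/-- `M` is moreover minimal: no bad-prefix automaton for `S` has a smaller arity, and no
deterministic, tight, permutation-complete one of the same arity has fewer states. -/
structure IsMinimalBPA {A : Type} {k : ℕ+} {n : ℕ} (S : Hyperproperty A)
    (M : DFA (Fin k → A) (Fin n)) : Prop extends IsTightPermCompleteBPA S M where
  arity_minimal : ∀ k' < k, ¬ HasBadPrefixAutomaton S k'
  size_minimal : ∀ (n' : ℕ) (M' : DFA (Fin k → A) (Fin n')), IsTightPermCompleteBPA S M' → n ≤ n'

/-! ### Teachers -/

/-- A teacher answers membership queries (words of any arity) and equivalence queries (deterministic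
automata of any arity). The answer `none` to an equivalence query means "yes"; otherwise a
counterexample is given by a representation, together with its arity. -/
structure Teacher (A : Type) where
  member : (k : ℕ+) → Word A k → Bool
  equiv : (k : ℕ+) → (n : ℕ) → DFA (Fin k → A) (Fin n) → Option ((c : ℕ+) × Word A c)

/-- The counterexamples to the conjecture that `M` is a bad-prefix automaton for `S`: a bad prefix,
given by a representation `w` of arity `c`, of which `M` accepts no representation, or
an accepted word that does not represent a bad prefix. -/
inductive IsCounterexample {A : Type} (S : Hyperproperty A) {k : ℕ+} {n : ℕ}
    (M : DFA (Fin k → A) (Fin n)) : (c : ℕ+) → Word A c → Prop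
  | missed {c : ℕ+} (w : Word A c) (hw : unzip w ∈ bad S)
      (h : ∀ v : Word A k, unzip v = unzip w → v ∉ M.accepts) : IsCounterexample S M c w
  | spurious (w : Word A k) (hw : w ∈ M.accepts) (h : unzip w ∉ bad S) : IsCounterexample S M k w

/-- The teacher is minimal-adequate for `S`. All its membership answers are right, and, for every
queried automaton `M` whose arity does not exceed the target arity `κ`, it says "yes" exactly if `M`
is a bad-prefix automaton for `S`, and otherwise returns a counterexample of arity at most `κ` that
is shortest among the counterexamples of arity at most `κ`. -/
structure MinimalAdequate {A : Type} (S : Hyperproperty A) (T : Teacher A) : Prop where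
  member_iff : ∀ (k : ℕ+) (w : Word A k), T.member k w = true ↔ unzip w ∈ bad S
  equiv_none_iff : ∀ κ, IsTargetArity S κ → ∀ (k : ℕ+) (n : ℕ) (M : DFA (Fin k → A) (Fin n)),
    k ≤ κ → (T.equiv k n M = none ↔ IsRepresentation S M.accepts)
  equiv_some : ∀ κ, IsTargetArity S κ → ∀ (k : ℕ+) (n : ℕ) (M : DFA (Fin k → A) (Fin n)),
    k ≤ κ → ∀ (c : ℕ+) (w : Word A c), T.equiv k n M = some ⟨c, w⟩ →
      IsCounterexample S M c w ∧ c ≤ κ ∧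
        ∀ (c' : ℕ+) (w' : Word A c'), c' ≤ κ → IsCounterexample S M c' w' → w.length ≤ w'.length

/-! ### Computations with a step count

The unit of time is an elementary operation on a letter of `A`, a bit, a state, a list cell or an
array cell. A letter of `A ^ k` is an array of `k` letters, so that copying, comparing or
addressing with it takes time `k`. -/

/-- A computation: its result and the number of elementary steps it takes. -/
structure Timed (α : Type) where
  val : α
  time : ℕ

namespace Timed

instance : Monad Timed where
  pure a := ⟨a, 0⟩
  bind x f := ⟨(f x.val).val, x.time + (f x.val).time⟩

/-- Spend `n` steps. -/
def tick (n : ℕ) : Timed Unit := ⟨(), n⟩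

/-- Apply `f` to all elements of a list. -/
def map {α β : Type} (f : α → Timed β) : List α → Timed (List β)
  | [] => do
      tick 1
      return []
  | x :: xs => do
      tick 1
      let y ← f x
      let ys ← map f xs
      return y :: ys

/-- The first success of `f` on a list. -/
def findSome {α β : Type} (f : α → Timed (Option β)) : List α → Timed (Option β)
  | [] => do
      tick 1
      return none
  | x :: xs => do
      tick 1
      match ← f x with
      | some y => return some y
      | none => findSome f xs

/-- Does some element of a list pass the test `f`? -/
def any {α : Type} (f : α → Timed Bool) : List α → Timed Bool
  | [] => do
      tick 1
      return false
  | x :: xs => do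
      tick 1
      match ← f x with
      | true => return true
      | false => any f xs

/-- Run through a list, updating an accumulator. -/
def fold {α β : Type} (f : β → α → Timed β) : β → List α → Timed β
  | b, [] => do
      tick 1
      return b
  | b, x :: xs => do
      tick 1
      let b' ← f b x
      fold f b' xs

/-- Add an element at the end of a list. -/
def snoc {α : Type} (l : List α) (x : α) : Timed (List α) := do
  tick (l.length + 1)
  return l ++ [x]

/-- Fill an array indexed by a finite type, cell by cell. -/
def tabulate {ι β : Type} [Fintype ι] (f : ι → Timed β) : Timed (ι → β) :=
  ⟨fun i => (f i).val, ∑ i, ((f i).time + 1)⟩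

/-- List all `k`-tuples of elements of a list. -/
def tuples {β : Type} (l : List β) : (k : ℕ) → Timed (List (Fin k → β))
  | 0 => do
      tick 1
      return [Fin.elim0]
  | k + 1 => do
      let vs ← tuples l k
      fold (fun acc b =>
        fold (fun acc' (v : Fin k → β) => do
          tick (k + 1)
          return (Fin.cons b v : Fin (k + 1) → β) :: acc') acc vs) [] l

end Timed

open Timed

/-! ### The learner -/

section Learner

variable {A : Type} [Fintype A] [DecidableEq A]

/-- All letters of `A ^ k`. -/
noncomputable def letters (A : Type) [Fintype A] (k : ℕ+) : Timed (List (Fin k → A)) :=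
  tuples (Finset.univ : Finset A).toList k

/-- Comparison of two rows of bits. -/
def eqRow (r r' : List Bool) : Timed Bool := do
  tick (r.length + r'.length + 1)
  return decide (r = r')

/-- Comparison of two words. -/
def eqWord {k : ℕ+} (w w' : Word A k) : Timed Bool := do
  tick (k * (w.length + w'.length) + 1)
  return decide (w = w')

/-- Concatenation of two words. -/
def concat {k : ℕ+} (w w' : Word A k) : Timed (Word A k) := do
  tick (k * (w.length + w'.length) + 1)
  return w ++ w'

/-- Extension of a `c`-tuple to a `k`-tuple, for `c ≤ k`, by repeating its last component. -/
def extendLetter {c : ℕ+} (k : ℕ+) (v : Fin c → A) : Fin k → A :=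
  fun i => v ⟨min i (c - 1), by have := c.pos; omega⟩

/-- Extension of a word to arity `k`. -/
def extend {c : ℕ+} (k : ℕ+) (w : Word A c) : Timed (Word A k) := do
  tick (k * w.length + 1)
  return w.map (extendLetter k)

/-- A membership query; the time is that of writing it down. -/
def ask (T : Teacher A) {k : ℕ+} (w : Word A k) : Timed Bool := do
  tick (k * w.length + 1)
  return T.member k w

/-- The line of an observation table that belongs to an accessing sequence `word`: the row of `word`
and the rows of all words `word · a`, with `a` a letter. -/
structure Entry (A : Type) (k : ℕ+) where
  word : Word A k
  row : List Bool
  succ : List ((Fin k → A) × List Bool)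

/-- An observation table over `A ^ k`: the separating sequences `E`, the empty word first, and one
entry for each accessing sequence. A row lists the answers for the words of `E`, in their order. -/
structure Table (A : Type) (k : ℕ+) where
  E : List (Word A k)
  entries : List (Entry A k)

/-- The row of a word: a membership query for each of its continuations by a word of `E`. -/
def askRow (T : Teacher A) {k : ℕ+} (E : List (Word A k)) (w : Word A k) : Timed (List Bool) :=
  Timed.map (fun e => do
    let we ← concat w e
    ask T we) E

/-- The observation table with accessing sequences `S` and separating sequences `E`, filled with
membership queries. -/
noncomputable def fill (T : Teacher A) {k : ℕ+} (S E : List (Word A k)) : Timed (Table A k) := do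
  let as ← letters A k
  let entries ← Timed.map (fun s => do
    let r ← askRow T E s
    let succ ← Timed.map (fun a => do
      let sa ← concat s [a]
      let r' ← askRow T E sa
      return (a, r')) as
    return (⟨s, r, succ⟩ : Entry A k)) S
  return ⟨E, entries⟩

/-- The accessing sequences of a table. -/
def accessing {k : ℕ+} (O : Table A k) : Timed (List (Word A k)) :=
  Timed.map (fun x => do
    tick 1
    return x.word) O.entries

/-- Consistency check. If two accessing sequences `s`, `t` have equal rows, but `s · a · e` and
`t · a · e` get different answers for a letter `a` and some `e` in `E`, then `a · e` is returned. -/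
def inconsistency {k : ℕ+} (O : Table A k) : Timed (Option (Word A k)) :=
  findSome (fun x => findSome (fun y => do
    match ← eqRow x.row y.row with
    | false => return none
    | true =>
      findSome (fun p => do
        findSome (fun q => do
          match q.2.1 == q.2.2 with
          | true => return none
          | false =>
            let ae ← concat [p.1.1] q.1
            return some ae)
          (O.E.zip (p.1.2.zip p.2.2)))
        (x.succ.zip y.succ)) O.entries) O.entries

/-- Closedness check. A word `s · a` whose row is not the row of any accessing sequence is
returned, if there is one. -/
def unclosed {k : ℕ+} (O : Table A k) : Timed (Option (Word A k)) :=
  findSome (fun x => findSome (fun p => do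
    match ← Timed.any (fun y => eqRow p.2 y.row) O.entries with
    | true => return none
    | false =>
      let sa ← concat x.word [p.1]
      return some sa) x.succ) O.entries

/-- A deterministic automaton over `A ^ k` with states `0, …, last`, stored in arrays. -/
structure Conjecture (A : Type) (k : ℕ+) where
  last : ℕ
  step : Fin (last + 1) → (Fin k → A) → Fin (last + 1)
  start : Fin (last + 1)
  accept : Fin (last + 1) → Bool

/-- The number of states. -/
abbrev Conjecture.size {k : ℕ+} (M : Conjecture A k) : ℕ := M.last + 1

/-- A conjecture as an automaton. -/
def Conjecture.toDFA {k : ℕ+} (M : Conjecture A k) : DFA (Fin k → A) (Fin M.size) where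
  step := M.step
  start := M.start
  accept := {q | M.accept q = true}

/-- The automaton of a closed and consistent table. Its states are the different rows of accessing
sequences, the row of the empty word being state `0`; a state is accepting if its first bit, which
belongs to the empty word, is `1`; and there is a transition with `a` from the row of `s` to the row
of `s · a`. -/
def conjecture {k : ℕ+} (O : Table A k) : Timed (Conjecture A k) := do
  let x₀ ← findSome (fun x => do
    match x.word with
    | [] => return some x
    | _ :: _ => return none) O.entries
  let x₀ : Entry A k := x₀.getD ⟨[], [], []⟩
  let others ← fold (fun xs x => do
    match ← Timed.any (fun y => eqRow x.row y.row) (x₀ :: xs) with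
    | true => return xs
    | false => snoc xs x) [] O.entries
  -- the states are put into an array
  tick (others.length + 1)
  let state : Fin (others.length + 1) → Entry A k := (x₀ :: others).get
  let step ← tabulate fun i => tabulate fun a : Fin k → A => do
    let r ← findSome (fun p => do
      tick (2 * k)
      return if p.1 = a then some p.2 else none) (state i).succ
    let j ← findSome (fun j => do
      match ← eqRow (r.getD []) (state j).row with
      | true => return some j
      | false => return none) (List.finRange (others.length + 1))
    tick k
    return j.getD 0
  let accept ← tabulate fun i => do
    tick 1
    return (state i).row.headD false
  return ⟨others.length, step, 0, accept⟩

/-- One round of the breadth-first search in the product of `M`, reading permuted letters,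
with `M`. The list `vis` holds the pairs of states reached so far, each with a word leading to it. -/
def searchRound {k : ℕ+} (M : Conjecture A k) (f : Fin k → Fin k) (as : List (Fin k → A))
    (vis : List (Word A k × Fin M.size × Fin M.size)) :
    Timed (List (Word A k × Fin M.size × Fin M.size)) :=
  fold (fun acc x => fold (fun acc' (a : Fin k → A) => do
    tick (4 * k)
    let p := M.step x.2.1 (fun i => a (f i))
    let q := M.step x.2.2 a
    match ← Timed.any (fun y => do
        tick 2
        return decide (y.2 = (p, q))) acc' with
    | true => return acc'
    | false =>
      let w ← concat x.1 [a]
      snoc acc' (w, p, q)) acc as) vis vis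

/-- A given number of rounds of the search. -/
def search {k : ℕ+} (M : Conjecture A k) (f : Fin k → Fin k) (as : List (Fin k → A)) :
    ℕ → List (Word A k × Fin M.size × Fin M.size) →
      Timed (List (Word A k × Fin M.size × Fin M.size))
  | 0, vis => do
      tick 1
      return vis
  | r + 1, vis => do
      tick 1
      let vis' ← searchRound M f as vis
      search M f as r vis'

/-- Check of permutation-completeness. For every function `f` from positions to positions, search
for a word that is not accepted by `M` although `M` accepts the word with letters permuted by `f`. -/
noncomputable def incompleteness {k : ℕ+} (M : Conjecture A k) : Timed (Option (Word A k)) := do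
  let as ← letters A k
  let fs ← tuples (List.finRange k) k
  findSome (fun f => do
    let vis ← search M f as (M.size * M.size) [([], M.start, M.start)]
    findSome (fun x => do
      tick 2
      return if M.accept x.2.1 = true ∧ M.accept x.2.2 = false then some x.1 else none) vis) fs

/-- Amend a table with a word: all its prefixes become accessing sequences. -/
noncomputable def amend (T : Teacher A) {k : ℕ+} (O : Table A k) (w : Word A k) :
    Timed (Table A k) := do
  let S ← accessing O
  tick ((w.length + 1) * (k * w.length + 1))
  let S' ← fold (fun S v => do
    match ← Timed.any (fun s => eqWord s v) S with
    | true => return S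
    | false => snoc S v) S w.inits
  fill T S' O.E

/-- Extend a table to a larger arity. -/
noncomputable def extendTable (T : Teacher A) {k : ℕ+} (c : ℕ+) (O : Table A k) :
    Timed (Table A c) := do
  let S ← accessing O
  let S' ← Timed.map (extend c) S
  let E' ← Timed.map (extend c) O.E
  fill T S' E'

/-- What one iteration of the learner leads to: a table over some arity `k` with which to go on,
together with the length of the counterexample that the teacher provided in this iteration (`0` if
there was none), or the final automaton. -/
inductive Outcome (A : Type) where
  | next (k : ℕ+) (O : Table A k) (cex : ℕ)
  | done (k : ℕ+) (M : Conjecture A k)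

/-- One iteration of the learner. -/
noncomputable def iteration (T : Teacher A) {k : ℕ+} (O : Table A k) : Timed (Outcome A) := do
  match ← inconsistency O with
  | some e =>
    let S ← accessing O
    let E ← snoc O.E e
    let O' ← fill T S E
    return .next k O' 0
  | none =>
  match ← unclosed O with
  | some s =>
    let S ← accessing O
    let S' ← snoc S s
    let O' ← fill T S' O.E
    return .next k O' 0
  | none =>
  let M ← conjecture O
  -- the time of writing down the equivalence query
  tick (M.size * Fintype.card A ^ (k : ℕ) * (k + 1) + M.size + 1)
  match T.equiv k M.size M.toDFA with
  | some ⟨c, w⟩ =>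
    -- the time of reading the counterexample
    tick (c * w.length + 1)
    if c ≤ k then
      let w' ← extend k w
      let O' ← amend T O w'
      return .next k O' w.length
    else
      let O₁ ← extendTable T c O
      let O₂ ← amend T O₁ w
      return .next c O₂ w.length
  | none =>
    match ← incompleteness M with
    | some w =>
      let O' ← amend T O w
      return .next k O' 0
    | none => return .done k M

/-- Started with the table `O`, the learner stops with the automaton `M`, after time `t`, and the
longest counterexample provided by the teacher meanwhile has length `m` (`0` if there was none). -/
inductive Runs (T : Teacher A) {k' : ℕ+} (M : Conjecture A k') :
    {k : ℕ+} → Table A k → (t m : ℕ) → Prop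
  | done {k : ℕ+} (O : Table A k) (h : (iteration T O).val = .done k' M) :
      Runs T M O (iteration T O).time 0
  | next {k : ℕ+} (O : Table A k) {c : ℕ+} (O' : Table A c) (l t m : ℕ)
      (h : (iteration T O).val = .next c O' l) (h' : Runs T M O' t m) :
      Runs T M O ((iteration T O).time + t) (max l m)

/-- The learning algorithm, started over arity `1` with the empty word as the only accessing
and separating sequence, stops with the automaton `M`, after time `t`, and the longest
counterexample provided by the teacher has length `m`. -/
def Learns (T : Teacher A) {k : ℕ+} (M : Conjecture A k) (t m : ℕ) : Prop :=
  ∃ t' : ℕ, t = (fill T (k := 1) [[]] [[]]).time + t' ∧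
    Runs T M (fill T (k := 1) [[]] [[]]).val t' m

end Learner

end HyperLearn

open HyperLearn

/-! The object to learn is a single regular language. Write `badWords S k` for all words over `A ^
k` that represent bad prefixes. A representation of arity `k` that is tight and permutation-complete
must equal `badWords S k` (`eq_badWords`), and `badWords S k` has these properties whenever some
representation of arity `k` exists. So, at the least arity `κ` of a bad-prefix automaton, the
minimal automaton asked for is the minimal DFA of `badWords S κ`; let `N` be its number of states.
It exists because bad words form a regular language over every arity
(`IsRepresentation.isRegular_badWords`). By `k₀`-safety `badWords S k₀` is a representation, whence
`κ ≤ k₀`.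

Termination is Angluin's argument with an extra coordinate for the arity. Repeating the last
component embeds `badWords S k` into `badWords S κ` for `k ≤ κ`, so no table ever has more than `N`
different rows (`rowCount_le`). Repairing an inconsistency or a lack of closedness creates a new
row. A misclassified word of the current arity makes the table inconsistent
(`IsConjecture.not_consistent`), and a counterexample of larger arity raises the arity, at most to
`κ`. `potential` weighs these three kinds of progress against each other and bounds the number of
iterations by a multiple of `κ * (N + 1)`.

Correctness at the end needs an argument of its own, since the teacher confirms only that the
conjecture is some representation. A conjecture answers correctly on the accessing sequences of its
states and on their continuations by one letter. Hence its language inherits from the bad words that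
accepted words stay accepted under continuation and that every rejected word has a rejected
continuation by a letter. With invariance under permutations, which the product search establishes,
this forces equality with `badWords` (`IsRepresentation.eq_badWords_of_closed`): a rejected bad word
could be continued forever through rejected words, but the resulting infinite word violates `S` and
must have an accepted prefix.

For the running time, every quantity in an iteration is bounded by a fixed power of one base `B`, so
that an iteration costs at most `B ^ 400`. Each iteration enlarges the table parameters by at most
the counterexample length plus `N * N + 1`, where `N * N` comes from the product search. One can
take `B` polynomial in `N + m` and in `(κ + 1) ^ κ`, the latter bounding the number of position maps
and, up to an exponent depending on the alphabet, the number of letters. -/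

namespace HyperLearn

open Timed

/-! ### Results and times of the basic computations -/

namespace Timed

@[simp] theorem pure_val {α : Type} (a : α) : (pure a : Timed α).val = a := rfl

@[simp] theorem pure_time {α : Type} (a : α) : (pure a : Timed α).time = 0 := rfl

@[simp] theorem bind_val {α β : Type} (x : Timed α) (f : α → Timed β) :
    (x >>= f).val = (f x.val).val := rfl

@[simp] theorem bind_time {α β : Type} (x : Timed α) (f : α → Timed β) :
    (x >>= f).time = x.time + (f x.val).time := rfl

@[simp] theorem tick_time (n : ℕ) : (tick n).time = n := rfl

@[simp] theorem snoc_val {α : Type} (l : List α) (x : α) : (snoc l x).val = l ++ [x] := rfl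

@[simp] theorem snoc_time {α : Type} (l : List α) (x : α) :
    (snoc l x).time = l.length + 1 := rfl

@[simp] theorem tabulate_val {ι β : Type} [Fintype ι] (f : ι → Timed β) :
    (tabulate f).val = fun i => (f i).val := rfl

@[simp] theorem map_val {α β : Type} (f : α → Timed β) (l : List α) :
    (Timed.map f l).val = l.map fun x => (f x).val := by
  induction l with
  | nil => rfl
  | cons x xs ih => simp [Timed.map, ih]

@[simp] theorem findSome_val {α β : Type} (f : α → Timed (Option β)) (l : List α) :
    (findSome f l).val = l.findSome? fun x => (f x).val := by
  induction l with
  | nil => rfl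
  | cons x xs ih =>
    rw [findSome, List.findSome?_cons]
    simp only [bind_val]
    cases (f x).val <;> simp [ih]

@[simp] theorem any_val {α : Type} (f : α → Timed Bool) (l : List α) :
    (Timed.any f l).val = l.any fun x => (f x).val := by
  induction l with
  | nil => rfl
  | cons x xs ih =>
    rw [Timed.any, List.any_cons]
    simp only [bind_val]
    cases (f x).val <;> simp [ih]

@[simp] theorem fold_val {α β : Type} (f : β → α → Timed β) (b : β) (l : List α) :
    (fold f b l).val = l.foldl (fun b x => (f b x).val) b := by
  induction l generalizing b with
  | nil => rfl
  | cons x xs ih => simp [fold, ih]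

theorem map_time_le {α β : Type} {f : α → Timed β} {l : List α} {c : ℕ}
    (h : ∀ x ∈ l, (f x).time ≤ c) : (Timed.map f l).time ≤ l.length * (c + 1) + 1 := by
  induction l with
  | nil => simp [Timed.map]
  | cons x xs ih =>
    have h₁ := h x (by simp)
    have h₂ := ih fun y hy => h y (by simp [hy])
    simp only [Timed.map, bind_time, tick_time, pure_time, List.length_cons]
    linarith

theorem findSome_time_le {α β : Type} {f : α → Timed (Option β)} {l : List α} {c : ℕ}
    (h : ∀ x ∈ l, (f x).time ≤ c) : (findSome f l).time ≤ l.length * (c + 1) + 1 := by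
  induction l with
  | nil => simp [findSome]
  | cons x xs ih =>
    have h₁ := h x (by simp)
    have h₂ := ih fun y hy => h y (by simp [hy])
    simp only [findSome, bind_time, tick_time, List.length_cons]
    cases (f x).val <;> simp only [pure_time] <;> linarith

theorem any_time_le {α : Type} {f : α → Timed Bool} {l : List α} {c : ℕ}
    (h : ∀ x ∈ l, (f x).time ≤ c) : (Timed.any f l).time ≤ l.length * (c + 1) + 1 := by
  induction l with
  | nil => simp [Timed.any]
  | cons x xs ih =>
    have h₁ := h x (by simp)
    have h₂ := ih fun y hy => h y (by simp [hy])
    simp only [Timed.any, bind_time, tick_time, List.length_cons]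
    cases (f x).val <;> simp only [pure_time] <;> linarith

/-- A loop with an invariant `P`, which may depend on the number of rounds done. -/
theorem fold_spec {α β : Type} {f : β → α → Timed β} {c : ℕ} (P : ℕ → β → Prop) {l : List α}
    (h : ∀ i b, ∀ x ∈ l, i < l.length → P i b → P (i + 1) (f b x).val ∧ (f b x).time ≤ c)
    {b : β} (hb : P 0 b) :
    P l.length (fold f b l).val ∧ (fold f b l).time ≤ l.length * (c + 1) + 1 := by
  induction l generalizing b P with
  | nil => simpa [fold] using hb
  | cons x xs ih =>
    have h₁ := h 0 b x (by simp) (by simp) hb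
    have h₂ := ih (fun i => P (i + 1))
      (fun i b y hy hi hP => h (i + 1) b y (by simp [hy]) (by simpa using hi) hP) h₁.1
    refine ⟨by simpa [fold] using h₂.1, ?_⟩
    simp only [fold, bind_time, tick_time, List.length_cons]
    linarith [h₁.2, h₂.2]

theorem tabulate_time_le {ι β : Type} [Fintype ι] {f : ι → Timed β} {c : ℕ}
    (h : ∀ i, (f i).time ≤ c) : (tabulate f).time ≤ Fintype.card ι * (c + 1) := by
  simp only [tabulate]
  refine (Finset.sum_le_card_nsmul _ _ (c + 1) fun i _ => Nat.succ_le_succ (h i)).trans ?_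
  simp [Finset.card_univ]

end Timed

/-! ### Bounds by powers of a common base -/

/-- All time bounds have the form `B ^ e` with a numeral `e`. Since `B ≥ 2`, a sum costs one extra
factor `B`. The wasteful exponent `a + b + 1` lets nested bounds be assembled as terms, with one
numerical comparison at the end. -/
theorem add_le_pow {B x y a b : ℕ} (hB : 2 ≤ B) (hx : x ≤ B ^ a) (hy : y ≤ B ^ b) :
    x + y ≤ B ^ (a + b + 1) := by
  have h₁ : B ^ a ≤ B ^ (a + b) := Nat.pow_le_pow_right (by omega) (by omega)
  have h₂ : B ^ b ≤ B ^ (a + b) := Nat.pow_le_pow_right (by omega) (by omega)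
  have h₃ : B ^ (a + b) * 2 ≤ B ^ (a + b + 1) := by
    rw [pow_succ]; exact Nat.mul_le_mul_left _ hB
  omega

theorem mul_le_pow {B x y a b : ℕ} (hx : x ≤ B ^ a) (hy : y ≤ B ^ b) :
    x * y ≤ B ^ (a + b) := by
  rw [pow_add]; exact Nat.mul_le_mul hx hy

theorem one_le_pow_zero {B : ℕ} : 1 ≤ B ^ 0 := by simp

theorem le_pow_one {B x : ℕ} (h : x ≤ B) : x ≤ B ^ 1 := by simpa using h

/-- The left side has the shape of the bounds for `map`, `findSome`, `any` and `fold`, with `x`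
rounds of cost `y`. -/
theorem loop_le_pow {B x y a b : ℕ} (hB : 2 ≤ B) (hx : x ≤ B ^ a) (hy : y ≤ B ^ b) :
    x * (y + 1) + 1 ≤ B ^ (a + b + 2) := by
  have h := add_le_pow hB (mul_le_pow hx (add_le_pow hB hy one_le_pow_zero)) one_le_pow_zero
  exact h.trans (Nat.pow_le_pow_right (by omega) (by omega))

theorem le_pow_of_le {B x a b : ℕ} (hB : 2 ≤ B) (hx : x ≤ B ^ a) (h : a ≤ b) : x ≤ B ^ b :=
  hx.trans (Nat.pow_le_pow_right (by omega) h)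

/-! ### Tuples -/

theorem mem_foldl_cons {α β : Type} (g : α → β) (l : List α) (acc : List β) (x : β) :
    x ∈ l.foldl (fun acc v => g v :: acc) acc ↔ x ∈ acc ∨ ∃ v ∈ l, g v = x := by
  induction l generalizing acc with
  | nil => simp
  | cons y ys ih =>
    rw [List.foldl_cons, ih]
    simp only [List.mem_cons, exists_eq_or_imp]
    grind

theorem mem_foldl_foldl_cons {α β γ : Type} (g : γ → α → β) (l : List γ) (vs : List α)
    (acc : List β) (x : β) :
    x ∈ l.foldl (fun acc b => vs.foldl (fun acc v => g b v :: acc) acc) acc ↔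
      x ∈ acc ∨ ∃ b ∈ l, ∃ v ∈ vs, g b v = x := by
  induction l generalizing acc with
  | nil => simp
  | cons y ys ih =>
    rw [List.foldl_cons, ih, mem_foldl_cons]
    simp only [List.mem_cons, exists_eq_or_imp]
    grind

theorem length_foldl_cons {α β : Type} (g : α → β) (l : List α) (acc : List β) :
    (l.foldl (fun acc v => g v :: acc) acc).length = acc.length + l.length := by
  induction l generalizing acc with
  | nil => simp
  | cons y ys ih => rw [List.foldl_cons, ih]; simp; omega

theorem length_foldl_foldl_cons {α β γ : Type} (g : γ → α → β) (l : List γ) (vs : List α)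
    (acc : List β) :
    (l.foldl (fun acc b => vs.foldl (fun acc v => g b v :: acc) acc) acc).length =
      acc.length + l.length * vs.length := by
  induction l generalizing acc with
  | nil => simp
  | cons y ys ih => rw [List.foldl_cons, ih, length_foldl_cons]; simp; ring

theorem tuples_succ_val {β : Type} (l : List β) (k : ℕ) :
    (tuples l (k + 1)).val = l.foldl (fun acc b =>
      (tuples l k).val.foldl (fun acc v => (Fin.cons b v : Fin (k + 1) → β) :: acc) acc) [] := by
  simp [tuples]

theorem mem_tuples {β : Type} {l : List β} {k : ℕ} {v : Fin k → β} (h : ∀ i, v i ∈ l) :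
    v ∈ (tuples l k).val := by
  induction k with
  | zero => simp [tuples, Subsingleton.elim v Fin.elim0]
  | succ k ih =>
    rw [tuples_succ_val, mem_foldl_foldl_cons]
    exact .inr ⟨v 0, h 0, Fin.tail v, ih fun i => h i.succ, Fin.cons_self_tail v⟩

theorem length_tuples {β : Type} (l : List β) (k : ℕ) :
    (tuples l k).val.length = l.length ^ k := by
  induction k with
  | zero => simp [tuples]
  | succ k ih => rw [tuples_succ_val, length_foldl_foldl_cons, ih]; simp [pow_succ, mul_comm]

theorem tuples_time_le {β : Type} {l : List β} {B k : ℕ} (hB : 2 ≤ B) (hk : k ≤ B)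
    (hl : (l.length + 1) ^ k ≤ B) : (tuples l k).time ≤ B ^ 11 := by
  obtain rfl | k0 := Nat.eq_zero_or_pos k
  · simp [tuples]; exact Nat.one_le_pow _ _ (by omega)
  have hl1 : l.length ≤ B := by
    refine le_trans ?_ hl
    exact (Nat.le_succ _).trans (Nat.le_self_pow k0.ne' _)
  -- The bound is linear in `j`: adding exponents at each level of the recursion would make the
  -- exponent depend on `k`.
  have key : ∀ j ≤ k, (tuples l j).time ≤ (j + 1) * B ^ 8 := by
    intro j hj
    induction j with
    | zero => simp [tuples]; exact Nat.one_le_pow _ _ (by omega)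
    | succ j ih =>
      have hvs : (tuples l j).val.length ≤ B ^ 1 := by
        rw [length_tuples, pow_one]
        refine le_trans ?_ hl
        exact (Nat.pow_le_pow_left (Nat.le_succ _) j).trans
          (Nat.pow_le_pow_right (by omega) (by omega))
      have inner : ∀ (acc : List (Fin (j + 1) → β)) (b : β), (fold (fun acc' (v : Fin j → β) => do
          tick (j + 1)
          return (Fin.cons b v : Fin (j + 1) → β) :: acc') acc (tuples l j).val).time ≤ B ^ 4 :=
        fun acc b => (fold_spec (c := j + 1) (fun _ _ => True) (by simp) trivial).2.trans
          (loop_le_pow hB hvs (le_pow_one (by omega)))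
      have outer := (fold_spec (c := B ^ 4) (fun _ _ => True) (l := l) (b := [])
        (fun i acc b _ _ _ => ⟨trivial, inner acc b⟩) trivial).2.trans
          (loop_le_pow hB (le_pow_one hl1) le_rfl)
      have := le_pow_of_le hB outer (b := 8) (by norm_num)
      have := ih (by omega)
      simp only [tuples, bind_time]
      rw [add_mul _ 1, one_mul]
      exact Nat.add_le_add ‹_› ‹_›
  exact le_pow_of_le hB ((key k le_rfl).trans
    (mul_le_pow (add_le_pow hB (le_pow_one hk) one_le_pow_zero) le_rfl)) (by norm_num)

/-! ### Infinite words and their prefixes -/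

section InfiniteWords

variable {α β : Type}

/-- The prefix of length `l` of an infinite word. -/
def takeω (τ : ℕ → α) (l : ℕ) : List α := (List.range l).map τ

/-- The infinite word `w · τ`. -/
def appendω (w : List α) (τ : ℕ → α) (n : ℕ) : α :=
  if h : n < w.length then w[n] else τ (n - w.length)

@[simp] theorem length_takeω (τ : ℕ → α) (l : ℕ) : (takeω τ l).length = l := by simp [takeω]

theorem takeω_succ (τ : ℕ → α) (l : ℕ) : takeω τ (l + 1) = takeω τ l ++ [τ l] := by
  simp [takeω, List.range_succ]

theorem map_takeω (g : α → β) (τ : ℕ → α) (l : ℕ) :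
    (takeω τ l).map g = takeω (fun n => g (τ n)) l := by
  simp [takeω]

theorem tracePrefix_iff {w : List α} {τ : ℕ → α} : TracePrefix w τ ↔ w = takeω τ w.length := by
  constructor
  · intro h
    apply List.ext_getElem (by simp)
    intro i h₁ _
    simpa [takeω] using h i h₁
  · intro h i hi
    have : w[i] = (takeω τ w.length)[i]'(by simpa using hi) := List.getElem_of_eq h hi
    simpa [takeω] using this

theorem tracePrefix_takeω (τ : ℕ → α) (l : ℕ) : TracePrefix (takeω τ l) τ :=
  tracePrefix_iff.2 (by simp)

theorem TracePrefix.map {w : List α} {τ : ℕ → α} (g : α → β) (h : TracePrefix w τ) :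
    TracePrefix (w.map g) fun n => g (τ n) := by
  intro i hi
  simpa using congrArg g (h i (by simpa using hi))

theorem TracePrefix.of_append {w u : List α} {τ : ℕ → α} (h : TracePrefix (w ++ u) τ) :
    TracePrefix w τ := by
  intro i hi
  rw [← h i (by simp; omega), List.getElem_append_left hi]

theorem takeω_appendω (w : List α) (τ : ℕ → α) (l : ℕ) :
    takeω (appendω w τ) (w.length + l) = w ++ takeω τ l := by
  apply List.ext_getElem (by simp)
  intro i h₁ h₂
  simp only [takeω, appendω, List.getElem_map, List.getElem_range, List.getElem_append]

theorem takeω_appendω_of_le (w : List α) (τ : ℕ → α) {l : ℕ} (h : l ≤ w.length) :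
    takeω (appendω w τ) l = w.take l := by
  apply List.ext_getElem (by simpa using h)
  intro i h₁ h₂
  have : i < w.length := by simp at h₁; omega
  simp [takeω, appendω, this]

theorem tracePrefix_append_iff {w u : List α} {τ : ℕ → α} :
    TracePrefix (w ++ u) τ ↔ ∃ τ', TracePrefix u τ' ∧ τ = appendω w τ' := by
  constructor
  · intro h
    refine ⟨fun n => τ (w.length + n), ?_, ?_⟩
    · intro i hi
      have := h (w.length + i) (by simpa using hi)
      simpa using this
    · funext n
      unfold appendω
      split_ifs with hn
      · exact (h.of_append n hn).symm
      · congr; omega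
  · rintro ⟨τ', h, rfl⟩
    rw [tracePrefix_iff] at h ⊢
    rw [List.length_append, takeω_appendω, ← h]

end InfiniteWords

/-! ### Bad prefixes -/

section BadPrefixes

variable {A : Type}

/-- The word over `A ^ c` whose `i`th component is the component `f i` of `w`. -/
def permute {k c : ℕ} (f : Fin c → Fin k) (w : List (Fin k → A)) : List (Fin c → A) :=
  w.map fun a i => a (f i)

/-- The set of the components of an infinite word over `A ^ k`. -/
def unzipω {k : ℕ} (τ : ℕ → Fin k → A) : Set (ℕ → A) := Set.range fun i n => τ n i

/-- All words over `A ^ k` that represent bad prefixes of `S`. -/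
def badWords (S : Hyperproperty A) (k : ℕ+) : Language (Fin k → A) := {w | unzip w ∈ bad S}

theorem mem_badWords {S : Hyperproperty A} {k : ℕ+} {w : Word A k} :
    w ∈ badWords S k ↔ unzip w ∈ bad S := Iff.rfl

theorem SetPrefix.mono {T U : Set (List A)} {T' : Set (ℕ → A)} (h : T ⊆ U) (hU : SetPrefix U T') :
    SetPrefix T T' := fun t ht => hU t (h ht)

theorem bad_mono {S : Hyperproperty A} {T U : Set (List A)} (h : T ⊆ U) (hT : T ∈ bad S) :
    U ∈ bad S := fun T' hT' => hT T' (hT'.mono h)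

theorem unzip_permute_subset {k c : ℕ+} (f : Fin c → Fin k) (w : Word A k) :
    unzip (k := c) (permute f w) ⊆ unzip w := by
  rintro _ ⟨i, rfl⟩
  exact ⟨f i, by simp [permute]⟩

/-- Each component of `v` is a prefix of some component of `τ`; choosing one for every index gives
`f`. It need be neither injective nor surjective, which is why permutation-completeness is tested
for arbitrary maps of positions. -/
theorem setPrefix_unzip_iff {k c : ℕ+} {v : Word A c} {τ : ℕ → Fin k → A} :
    SetPrefix (unzip v) (unzipω τ) ↔ ∃ f : Fin c → Fin k, v = permute f (takeω τ v.length) := by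
  constructor
  · intro h
    have h' : ∀ i : Fin c, ∃ j : Fin k, TracePrefix (v.map fun a => a i) fun n => τ n j := by
      intro i
      obtain ⟨_, ⟨j, rfl⟩, hj⟩ := h _ ⟨i, rfl⟩
      exact ⟨j, hj⟩
    choose f hf using h'
    refine ⟨f, ?_⟩
    rw [permute, map_takeω, ← tracePrefix_iff]
    intro n hn
    funext i
    exact (List.getElem_map _).symm.trans (hf i n (by simpa using hn))
  · rintro ⟨f, hf⟩ _ ⟨i, rfl⟩
    rw [permute, map_takeω, ← tracePrefix_iff] at hf
    exact ⟨_, ⟨f i, rfl⟩, hf.map fun a => a i⟩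

/-! ### Violating sets and bad words in the presence of a representation -/

variable {S : Hyperproperty A}

/-- A violation is witnessed by a represented prefix, which is also a prefix of every larger set. -/
theorem IsRepresentation.notMem_mono {k : ℕ+} {L : Language (Fin k → A)}
    (hL : IsRepresentation S L) {T' U' : Set (ℕ → A)} (hT : T' ∉ S) (h : T' ⊆ U') : U' ∉ S := by
  obtain ⟨w, hw, hp, hb⟩ := (hL.2 T').1 hT
  refine (hL.2 U').2 ⟨w, hw, fun t ht => ?_, hb⟩
  obtain ⟨t', ht', hp'⟩ := hp t ht
  exact ⟨t', h ht', hp'⟩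

/-- Arities are positive, so no represented set is empty, while only the empty set is a prefix of
`∅`. This later rules out the empty bad prefix, which has no representation. -/
theorem IsRepresentation.empty_mem {k : ℕ+} {L : Language (Fin k → A)}
    (hL : IsRepresentation S L) : ∅ ∈ S := by
  by_contra h
  obtain ⟨w, -, hp, -⟩ := (hL.2 ∅).1 h
  obtain ⟨t', ht', -⟩ := hp _ ⟨⟨0, k.pos⟩, rfl⟩
  exact ht'.elim

/-- A violating set of the form `unzipω τ` is recognized from a prefix of `τ`. -/
theorem IsRepresentation.unzipω_notMem_iff {k c : ℕ+} {L : Language (Fin c → A)}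
    (hL : IsRepresentation S L) {τ : ℕ → Fin k → A} :
    unzipω τ ∉ S ↔ ∃ (l : ℕ) (f : Fin c → Fin k), permute f (takeω τ l) ∈ L := by
  rw [hL.2]
  constructor
  · rintro ⟨w, hw, hp, -⟩
    obtain ⟨f, hf⟩ := setPrefix_unzip_iff.1 hp
    exact ⟨w.length, f, hf ▸ hw⟩
  · rintro ⟨l, f, h⟩
    exact ⟨_, h, setPrefix_unzip_iff.2 ⟨f, by simp [permute]⟩, hL.1 _ h⟩

theorem tracePrefix_setPrefix {k : ℕ+} {w : Word A k} {τ : ℕ → Fin k → A} (h : TracePrefix w τ) :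
    SetPrefix (unzip w) (unzipω τ) := by
  rintro _ ⟨i, rfl⟩
  exact ⟨_, ⟨i, rfl⟩, h.map fun a => a i⟩

theorem exists_tracePrefix_of_setPrefix {k : ℕ+} {w : Word A k} {T' : Set (ℕ → A)}
    (h : SetPrefix (unzip w) T') : ∃ τ : ℕ → Fin k → A, TracePrefix w τ ∧ unzipω τ ⊆ T' := by
  have h' : ∀ i : Fin k, ∃ t' ∈ T', TracePrefix (w.map fun a => a i) t' := fun i => h _ ⟨i, rfl⟩
  choose t ht hp using h'
  refine ⟨fun n i => t i n, fun n hn => ?_, ?_⟩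
  · funext i
    exact (List.getElem_map _).symm.trans (hp i n (by simpa using hn))
  · rintro _ ⟨i, rfl⟩
    exact ht i

/-- It suffices to test sets of `k` traces: a set extending `unzip w` contains traces that continue
the components of `w`, and violation passes to supersets. -/
theorem IsRepresentation.mem_badWords_iff {k c : ℕ+} {L : Language (Fin c → A)}
    (hL : IsRepresentation S L) {w : Word A k} :
    w ∈ badWords S k ↔ ∀ τ : ℕ → Fin k → A, TracePrefix w τ → unzipω τ ∉ S := by
  constructor
  · exact fun h τ hτ => h _ (tracePrefix_setPrefix hτ)
  · intro h T' hT'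
    obtain ⟨τ, hτ, hsub⟩ := exists_tracePrefix_of_setPrefix hT'
    exact hL.notMem_mono (h τ hτ) hsub

theorem append_mem_badWords {k : ℕ+} {w : Word A k} (h : w ∈ badWords S k) (u : Word A k) :
    w ++ u ∈ badWords S k := by
  intro T' hT'
  obtain ⟨τ, hτ, hsub⟩ := exists_tracePrefix_of_setPrefix hT'
  refine h T' fun t ht => ?_
  obtain ⟨t', ht', hp⟩ := tracePrefix_setPrefix hτ.of_append t ht
  exact ⟨t', hsub ht', hp⟩

/-- Some set in `S` extends the word; the next letter is read off from traces in that set. -/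
theorem exists_snoc_notMem_badWords {k : ℕ+} {w : Word A k} (h : w ∉ badWords S k) :
    ∃ a, w ++ [a] ∉ badWords S k := by
  simp only [mem_badWords, bad, Set.mem_ofPred_eq, not_forall, not_not] at h
  obtain ⟨T', hT', hS⟩ := h
  obtain ⟨τ, hτ, hsub⟩ := exists_tracePrefix_of_setPrefix hT'
  refine ⟨τ w.length, fun hb => hb T' (fun t ht => ?_) hS⟩
  have : TracePrefix (w ++ [τ w.length]) τ := by
    conv => arg 1; rw [tracePrefix_iff.1 hτ]
    simpa [takeω_succ] using tracePrefix_takeω τ (w.length + 1)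
  obtain ⟨u, hu, hp⟩ := tracePrefix_setPrefix this t ht
  exact ⟨u, hsub hu, hp⟩

/-- The bad prefixes of a regular hyperproperty form a regular language over each arity. -/
theorem IsRepresentation.isRegular_badWords {c : ℕ+} {L : Language (Fin c → A)}
    (hL : IsRepresentation S L) (hreg : L.IsRegular) (k : ℕ+) : (badWords S k).IsRegular := by
  obtain ⟨σ, _, D, rfl⟩ := hreg
  apply Language.IsRegular.of_finite_range_leftQuotient
  -- Finite information that determines the left quotient by `w`: whether some prefix of `w` is
  -- already accepted under some `f`, and the state reached on `permute f w` for each `f`.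
  let data : Word A k → Prop × ((Fin c → Fin k) → σ) := fun w =>
    (∃ l ≤ w.length, ∃ f : Fin c → Fin k, permute f (w.take l) ∈ D.accepts,
      fun f => D.eval (permute f w))
  have hmem : ∀ w u : Word A k, w ++ u ∈ badWords S k ↔
      (data w).1 ∨ ∀ τ : ℕ → Fin k → A, TracePrefix u τ →
        ∃ (l : ℕ) (f : Fin c → Fin k),
          D.evalFrom ((data w).2 f) (permute f (takeω τ l)) ∈ D.accept := by
    intro w u
    have hsplit : ∀ (τ : ℕ → Fin k → A) (l : ℕ) (f : Fin c → Fin k),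
        permute f (takeω (appendω w τ) (w.length + l)) ∈ D.accepts ↔
          D.evalFrom ((data w).2 f) (permute f (takeω τ l)) ∈ D.accept := by
      intro τ l f
      rw [takeω_appendω, permute, List.map_append, DFA.mem_accepts, DFA.eval,
        DFA.evalFrom_of_append]
      rfl
    rw [hL.mem_badWords_iff]
    constructor
    · intro h
      by_cases hd : (data w).1
      · exact .inl hd
      refine .inr fun τ hτ => ?_
      obtain ⟨l, f, hlf⟩ := hL.unzipω_notMem_iff.1
        (h (appendω w τ) (tracePrefix_append_iff.2 ⟨τ, hτ, rfl⟩))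
      -- The accepted prefix ends either inside `w`, which is the first component of `data`, or
      -- after `w`, where only the states matter.
      rcases le_total l w.length with hl | hl
      · rw [takeω_appendω_of_le w τ hl] at hlf
        exact absurd ⟨l, hl, f, hlf⟩ hd
      · obtain ⟨l, rfl⟩ := Nat.exists_eq_add_of_le hl
        exact ⟨l, f, (hsplit τ l f).1 hlf⟩
    · intro h τ' hτ'
      obtain ⟨τ, hτ, rfl⟩ := tracePrefix_append_iff.1 hτ'
      rw [hL.unzipω_notMem_iff]
      rcases h with ⟨l, hl, f, hlf⟩ | h
      · exact ⟨l, f, by rwa [takeω_appendω_of_le w τ hl]⟩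
      · obtain ⟨l, f, hlf⟩ := h τ hτ
        exact ⟨w.length + l, f, (hsplit τ l f).2 hlf⟩
  have hfac : (badWords S k).leftQuotient.FactorsThrough data := by
    intro w w' hw
    ext u
    rw [Language.mem_leftQuotient, Language.mem_leftQuotient, hmem, hmem, hw]
  obtain ⟨e, he⟩ := (Function.factorsThrough_iff _).1 hfac
  rw [he]
  exact (Set.finite_range e).subset (Set.range_comp_subset_range _ _)

/-! ### The bad words as a tight and permutation-complete representation -/

theorem IsRepresentation.badWords {k : ℕ+} {L : Language (Fin k → A)}
    (hL : IsRepresentation S L) : IsRepresentation S (badWords S k) := by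
  refine ⟨fun w hw => hw, fun T' => ⟨fun h => ?_, ?_⟩⟩
  · obtain ⟨w, -, hp, hb⟩ := (hL.2 T').1 h
    exact ⟨w, hb, hp, hb⟩
  · rintro ⟨w, hw, hp, -⟩
    exact hw T' hp

/-- Surplus indices repeat some element, so the set must be nonempty. -/
theorem exists_range_eq_of_encard_le {α : Type} {T : Set α} {k : ℕ} (hT : T.Nonempty)
    (h : T.encard ≤ k) : ∃ g : Fin k → α, Set.range g = T := by
  have hfin : T.Finite := Set.finite_of_encard_le_coe h
  have := hT.to_subtype
  have := hfin.fintype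
  have hc : Fintype.card T ≤ Fintype.card (Fin k) := by
    rw [Set.encard_eq_coe_toFinset_card, Set.toFinset_card] at h
    rw [Fintype.card_fin]
    exact_mod_cast h
  obtain ⟨e⟩ := Function.Embedding.nonempty_of_card_le hc
  refine ⟨fun i => (Function.invFun e i : T), ?_⟩
  ext x
  constructor
  · rintro ⟨i, rfl⟩
    exact (Function.invFun e i).2
  · intro hx
    exact ⟨e ⟨x, hx⟩, by simp [Function.leftInverse_invFun e.injective ⟨x, hx⟩]⟩

/-- The traces of a small bad prefix may have different lengths. Prolonging each along the violating
trace it belongs to gives a common length, and longer traces only strengthen a bad prefix. -/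
theorem IsKSafety.isRepresentation_badWords {k : ℕ+} (hS : IsKSafety S k) (h0 : ∅ ∈ S) :
    IsRepresentation S (badWords S k) := by
  refine ⟨fun w hw => hw, fun T' => ⟨fun h => ?_, ?_⟩⟩
  · obtain ⟨T, hT, hcard, hp⟩ := hS T' h
    have hne : T.Nonempty := by
      rw [Set.nonempty_iff_ne_empty]
      rintro rfl
      exact hT ∅ (fun t ht => ht.elim) h0
    obtain ⟨g, rfl⟩ := exists_range_eq_of_encard_le hne hcard
    have h' : ∀ i, ∃ t' ∈ T', TracePrefix (g i) t' := fun i => hp _ ⟨i, rfl⟩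
    choose t ht hpt using h'
    let τ : ℕ → Fin k → A := fun n i => t i n
    let l := Finset.univ.sup fun i => (g i).length
    have hw : unzip (takeω τ l : Word A k) ∈ bad S := by
      intro U hU
      refine hT U ?_
      rintro _ ⟨i, rfl⟩
      obtain ⟨u, hu, hpu⟩ := hU _ ⟨i, rfl⟩
      refine ⟨u, hu, fun n hn => ?_⟩
      have hl : n < l := lt_of_lt_of_le hn (Finset.le_sup (f := fun i => (g i).length)
        (Finset.mem_univ i))
      rw [← hpu n (by simpa using hl), hpt i n hn]
      simp [takeω, τ]
    refine ⟨_, hw, ?_, hw⟩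
    rintro _ ⟨i, rfl⟩
    exact ⟨t i, ht i, (tracePrefix_takeω τ l).map fun a => a i⟩
  · rintro ⟨w, hw, hp, -⟩
    exact hw T' hp

theorem isTight_badWords {k : ℕ+} (h0 : ∅ ∈ S) : IsTight S (badWords S k) := by
  rintro T hT hcard ⟨l, hl⟩
  have hne : T.Nonempty := by
    rw [Set.nonempty_iff_ne_empty]
    rintro rfl
    exact hT ∅ (fun t ht => ht.elim) h0
  obtain ⟨g, rfl⟩ := exists_range_eq_of_encard_le hne hcard
  have hgl : ∀ i, (g i).length = l := fun i => hl _ ⟨i, rfl⟩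
  let w : Word A k := List.ofFn fun (n : Fin l) i => (g i)[n.1]'(by rw [hgl]; exact n.2)
  have hw : unzip w = Set.range g := by
    refine congrArg Set.range (funext fun i => ?_)
    apply List.ext_getElem (by simp [w, hgl])
    intro n h₁ h₂
    simp [w]
  exact ⟨w, by rwa [mem_badWords, hw], hw⟩

theorem isPermComplete_badWords {k : ℕ+} : IsPermComplete (badWords S k) := by
  intro w hw w' h
  rwa [mem_badWords, h]

/-- A representation that is tight and permutation-complete contains all representations of bad
prefixes. -/
theorem eq_badWords {k : ℕ+} {L : Language (Fin k → A)} (hL : IsRepresentation S L)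
    (ht : IsTight S L) (hp : IsPermComplete L) : L = badWords S k := by
  ext w
  refine ⟨hL.1 w, fun hw => ?_⟩
  obtain ⟨v, hv, hvw⟩ := ht _ hw
    (by
      rw [unzip, ← Set.image_univ]
      refine (Set.encard_image_le _ _).trans ?_
      simp)
    ⟨w.length, by rintro _ ⟨i, rfl⟩; simp⟩
  exact hp v hv w hvw.symm

/-- A representation contains all representations of bad prefixes if it is closed under
continuation, contains a word with all its continuations by a letter, and is invariant under the
maps `permute f`. -/
theorem IsRepresentation.eq_badWords_of_closed {k : ℕ+} {L : Language (Fin k → A)}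
    (hL : IsRepresentation S L) (hsnoc : ∀ w ∈ L, ∀ a, w ++ [a] ∈ L)
    (hdown : ∀ w ∉ L, ∃ a, w ++ [a] ∉ L)
    (hperm : ∀ (f : Fin k → Fin k) (w : Word A k), permute f w ∈ L → w ∈ L) :
    L = HyperLearn.badWords S k := by
  have happ : ∀ (u w : Word A k), w ∈ L → w ++ u ∈ L := by
    intro u
    induction u with
    | nil => simp
    | cons a u ih =>
      intro w hw
      simpa using ih _ (hsnoc w hw a)
  ext w
  refine ⟨hL.1 w, fun hw => ?_⟩
  by_contra hn
  -- From the supposed bad word `w ∉ L`, letters that avoid `L` are appended forever; `τ` is the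
  -- infinite word of these letters.
  choose next hnext using fun v : {v : Word A k // v ∉ L} => hdown v.1 v.2
  let g : ℕ → {v : Word A k // v ∉ L} := fun n =>
    Nat.rec ⟨w, hn⟩ (fun _ v => ⟨v.1 ++ [next v], hnext v⟩) n
  let τ : ℕ → Fin k → A := fun n => next (g n)
  have hg : ∀ n, (g n).1 = w ++ takeω τ n := by
    intro n
    induction n with
    | zero => simp [g, takeω]
    | succ n ih =>
      rw [takeω_succ, ← List.append_assoc, ← ih]
  have hτ : TracePrefix w (appendω w τ) := by
    simpa [takeω_appendω_of_le] using tracePrefix_takeω (appendω w τ) w.length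
  -- As `w` is bad, `appendω w τ` violates `S`. So `L` contains a permuted prefix of it, and by
  -- `hperm` the prefix itself. Inside `w` this contradicts closure under continuation, beyond `w`
  -- the choice of `τ`.
  obtain ⟨l, f, hlf⟩ := hL.unzipω_notMem_iff.1 (hw _ (tracePrefix_setPrefix hτ))
  have hmem := hperm f _ hlf
  rcases le_total l w.length with hl | hl
  · rw [takeω_appendω_of_le w τ hl] at hmem
    exact hn (List.take_append_drop l w ▸ happ _ _ hmem)
  · obtain ⟨l, rfl⟩ := Nat.exists_eq_add_of_le hl
    rw [takeω_appendω, ← hg] at hmem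
    exact (g l).2 hmem

/-- Extension of a word to a larger arity does not change the set it represents. -/
theorem unzip_extend {c k : ℕ+} (h : c ≤ k) (w : Word A c) :
    unzip (w.map (extendLetter k)) = unzip w := by
  have hck : (c : ℕ) ≤ k := h
  apply Set.Subset.antisymm
  · rintro _ ⟨i, rfl⟩
    exact ⟨⟨min i (c - 1), by have := c.pos; omega⟩, by simp [extendLetter]⟩
  · rintro _ ⟨i, rfl⟩
    refine ⟨⟨i, by omega⟩, ?_⟩
    have : min (i : ℕ) (c - 1) = i := by omega
    simp [extendLetter, this]

theorem map_extend_mem_badWords_iff {c k : ℕ+} (h : c ≤ k) {w : Word A c} :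
    w.map (extendLetter k) ∈ badWords S k ↔ w ∈ badWords S c := by
  rw [mem_badWords, unzip_extend h, mem_badWords]

theorem IsRegularHyper.exists_isTargetArity (h : IsRegularHyper S) : ∃ κ, IsTargetArity S κ := by
  obtain ⟨κ, hκ, hmin⟩ := WellFounded.has_min (wellFounded_lt (α := ℕ+))
    {k | HasBadPrefixAutomaton S k} h
  exact ⟨κ, hκ, fun k' hk' hb => hmin k' hb hk'⟩

end BadPrefixes

/-! ### Results of the parts of the learner -/

/-- Loops with an invariant `P`, which establish `Q x` in the round for `x`. -/
theorem foldl_inv {α β : Type} {step : β → α → β} {l : List α} (P : β → Prop) (Q : α → β → Prop)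
    (h : ∀ b, ∀ x ∈ l, P b → P (step b x) ∧ Q x (step b x))
    (hmono : ∀ b, ∀ x ∈ l, ∀ y ∈ l, P b → Q y b → Q y (step b x)) {b : β} (hb : P b) :
    P (l.foldl step b) ∧ ∀ x ∈ l, Q x (l.foldl step b) := by
  -- Generalized to a rest `l'` of the list and a set `D` of elements already treated, so that the
  -- induction carries `Q` along.
  suffices H : ∀ (l' : List α) (D : Set α) (b : β), (∀ x ∈ l', x ∈ l) → (∀ y ∈ D, y ∈ l) → P b →
      (∀ y ∈ D, Q y b) → P (l'.foldl step b) ∧ ∀ x, x ∈ D ∨ x ∈ l' → Q x (l'.foldl step b) by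
    have := H l ∅ b (fun _ h => h) (by simp) hb (by simp)
    exact ⟨this.1, fun x hx => this.2 x (.inr hx)⟩
  intro l'
  induction l' with
  | nil => intro D b _ _ hb hD; exact ⟨hb, fun x hx => hD x (by simpa using hx)⟩
  | cons x xs ih =>
    intro D b hl hDl hb hD
    have hx : x ∈ l := hl x (by simp)
    have := ih (insert x D) (step b x) (fun y hy => hl y (by simp [hy]))
      (by rintro y (rfl | hy); exacts [hx, hDl y hy]) (h b x hx hb).1
      (by rintro y (rfl | hy); exacts [(h b y hx hb).2, hmono b x hx y (hDl y hy) hb (hD y hy)])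
    refine ⟨this.1, fun y hy => this.2 y ?_⟩
    simp only [List.mem_cons] at hy
    simp only [Set.mem_insert_iff]
    tauto

section Learner

set_option linter.unusedSectionVars false

variable {A : Type} [Fintype A] [DecidableEq A] {k : ℕ+}

theorem mem_letters (a : Fin k → A) : a ∈ (letters A k).val := mem_tuples fun _ => by simp

theorem length_letters : (letters A k).val.length = Fintype.card A ^ (k : ℕ) := by
  simp [letters, length_tuples]

@[simp] theorem eqRow_val (r r' : List Bool) : (eqRow r r').val = decide (r = r') := rfl

@[simp] theorem eqWord_val (w w' : Word A k) : (eqWord w w').val = decide (w = w') := rfl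

@[simp] theorem concat_val (w w' : Word A k) : (concat w w').val = w ++ w' := rfl

@[simp] theorem concat_time (w w' : Word A k) :
    (concat w w').time = k * (w.length + w'.length) + 1 := rfl

variable (T : Teacher A)

@[simp] theorem ask_val (w : Word A k) : (ask T w).val = T.member k w := rfl

@[simp] theorem ask_time (w : Word A k) : (ask T w).time = k * w.length + 1 := rfl

/-- The row of a word. -/
def rowOf (E : List (Word A k)) (w : Word A k) : List Bool := E.map fun e => T.member k (w ++ e)

/-- The line of an observation table that belongs to the accessing sequence `s`. -/
noncomputable def entryOf (E : List (Word A k)) (s : Word A k) : Entry A k :=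
  ⟨s, rowOf T E s, (letters A k).val.map fun a => (a, rowOf T E (s ++ [a]))⟩

/-- The observation table with accessing sequences `S` and separating sequences `E`. -/
noncomputable def tableOf (S E : List (Word A k)) : Table A k := ⟨E, S.map (entryOf T E)⟩

@[simp] theorem askRow_val (E : List (Word A k)) (w : Word A k) :
    (askRow T E w).val = rowOf T E w := by
  simp [askRow, rowOf]

theorem fill_val (S E : List (Word A k)) : (fill T S E).val = tableOf T S E := by
  simp [fill, tableOf, entryOf]

theorem accessing_val (S E : List (Word A k)) : (accessing (tableOf T S E)).val = S := by
  simp [accessing, tableOf, entryOf, Function.comp_def]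

/-- Consistency of an observation table. -/
def Consistent (S E : List (Word A k)) : Prop :=
  ∀ s ∈ S, ∀ t ∈ S, rowOf T E s = rowOf T E t → ∀ a, rowOf T E (s ++ [a]) = rowOf T E (t ++ [a])

/-- Closedness of an observation table. -/
def Closed (S E : List (Word A k)) : Prop :=
  ∀ s ∈ S, ∀ a, ∃ t ∈ S, rowOf T E (s ++ [a]) = rowOf T E t

variable {T} {S E : List (Word A k)}

/-- The zipped lists pair matching answers, because all rows follow the order of `E` and all
successor lists that of `letters`. -/
theorem inconsistency_val : (inconsistency (tableOf T S E)).val =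
    S.findSome? fun s => S.findSome? fun t =>
      if rowOf T E s = rowOf T E t then
        (letters A k).val.findSome? fun a => E.findSome? fun e =>
          if T.member k (s ++ [a] ++ e) = T.member k (t ++ [a] ++ e) then none
          else some ([a] ++ e)
      else none := by
  simp only [inconsistency, tableOf, findSome_val, List.findSome?_map]
  congr 1; funext s
  simp only [Function.comp_apply]
  congr 1; funext t
  simp only [Function.comp_apply, bind_val, eqRow_val, entryOf, List.zip_map', rowOf]
  by_cases h : rowOf T E s = rowOf T E t
  · have h' := h
    simp only [rowOf] at h'
    simp only [h', decide_true, if_true, findSome_val, List.findSome?_map]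
    congr 1; funext a
    simp only [Function.comp_apply, List.zip_map']
    have hz : E.zip (E.map fun x => (T.member k (s ++ [a] ++ x), T.member k (t ++ [a] ++ x))) =
        E.map fun x => (x, (T.member k (s ++ [a] ++ x), T.member k (t ++ [a] ++ x))) := by
      conv_lhs => arg 1; rw [← List.map_id E]
      rw [List.zip_map']
      simp
    rw [hz, List.findSome?_map]
    congr 1; funext e
    simp only [Function.comp_apply]
    by_cases h₂ : T.member k (s ++ [a] ++ e) = T.member k (t ++ [a] ++ e)
    · rw [if_pos h₂, beq_iff_eq.2 h₂]
      rfl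
    · rw [if_neg h₂, beq_eq_false_iff_ne.2 h₂]
      rfl
  · have h' := h
    simp only [rowOf] at h'
    simp [h']

theorem consistent_of_inconsistency (h : (inconsistency (tableOf T S E)).val = none) :
    Consistent T S E := by
  intro s hs t ht hst a
  rw [inconsistency_val, List.findSome?_eq_none_iff] at h
  have h := List.findSome?_eq_none_iff.1 (h s hs) t ht
  rw [if_pos hst, List.findSome?_eq_none_iff] at h
  have h := List.findSome?_eq_none_iff.1 (h a (mem_letters a))
  refine List.map_congr_left fun e he => ?_
  by_contra hne
  have := h e he
  rw [if_neg hne] at this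
  simp at this

theorem exists_of_inconsistency {v : Word A k}
    (h : (inconsistency (tableOf T S E)).val = some v) :
    ∃ s ∈ S, ∃ t ∈ S, ∃ a, ∃ e ∈ E, v = a :: e ∧ rowOf T E s = rowOf T E t ∧
      T.member k (s ++ v) ≠ T.member k (t ++ v) := by
  rw [inconsistency_val] at h
  obtain ⟨s, hs, h⟩ := List.exists_of_findSome?_eq_some h
  obtain ⟨t, ht, h⟩ := List.exists_of_findSome?_eq_some h
  split_ifs at h with hst
  obtain ⟨a, -, h⟩ := List.exists_of_findSome?_eq_some h
  obtain ⟨e, he, h⟩ := List.exists_of_findSome?_eq_some h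
  split_ifs at h with hne
  obtain rfl : [a] ++ e = v := by simpa using h
  exact ⟨s, hs, t, ht, a, e, he, rfl, hst, by simpa using hne⟩

theorem unclosed_val : (unclosed (tableOf T S E)).val =
    S.findSome? fun s => (letters A k).val.findSome? fun a =>
      if ∃ t ∈ S, rowOf T E (s ++ [a]) = rowOf T E t then none else some (s ++ [a]) := by
  simp only [unclosed, tableOf, findSome_val, List.findSome?_map]
  congr 1; funext s
  simp only [Function.comp_apply, entryOf, List.findSome?_map]
  congr 1; funext a
  simp only [Function.comp_apply, bind_val, any_val, eqRow_val, List.any_map, Function.comp_def]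
  by_cases h : ∃ t ∈ S, rowOf T E (s ++ [a]) = rowOf T E t
  · have h' : (S.any fun t => decide (rowOf T E (s ++ [a]) = (entryOf T E t).row)) = true := by
      obtain ⟨t, ht, h⟩ := h
      exact List.any_eq_true.2 ⟨t, ht, decide_eq_true h⟩
    rw [if_pos h, h']
    simp
  · have h' : (S.any fun t => decide (rowOf T E (s ++ [a]) = (entryOf T E t).row)) = false :=
      List.any_eq_false.2 fun t ht h' => h ⟨t, ht, of_decide_eq_true h'⟩
    rw [if_neg h, h']
    simp

theorem closed_of_unclosed (h : (unclosed (tableOf T S E)).val = none) : Closed T S E := by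
  intro s hs a
  rw [unclosed_val, List.findSome?_eq_none_iff] at h
  have h := List.findSome?_eq_none_iff.1 (h s hs) a (mem_letters a)
  by_contra hne
  rw [if_neg hne] at h
  simp at h

theorem exists_of_unclosed {v : Word A k} (h : (unclosed (tableOf T S E)).val = some v) :
    ∃ s ∈ S, ∃ a, v = s ++ [a] ∧ ∀ t ∈ S, rowOf T E v ≠ rowOf T E t := by
  rw [unclosed_val] at h
  obtain ⟨s, hs, h⟩ := List.exists_of_findSome?_eq_some h
  obtain ⟨a, -, h⟩ := List.exists_of_findSome?_eq_some h
  split_ifs at h with hst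
  obtain rfl : s ++ [a] = v := by simpa using h
  push Not at hst
  exact ⟨s, hs, a, rfl, hst⟩

/-- The relation of a conjecture to the table it is made from: each state stands for the row of
an accessing sequence. -/
structure IsConjecture (T : Teacher A) (S E : List (Word A k)) (M : Conjecture A k)
    (σ : Fin M.size → Word A k) : Prop where
  mem : ∀ i, σ i ∈ S
  start : rowOf T E (σ M.start) = rowOf T E []
  step : ∀ i a, rowOf T E (σ (M.step i a)) = rowOf T E (σ i ++ [a])
  accept : ∀ i, M.accept i = (rowOf T E (σ i)).headD false
  injective : Function.Injective fun i => rowOf T E (σ i)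

/-- Greedy choice of one representative for each row; `p` holds the representatives fixed
beforehand, here the entry of the empty word. -/
theorem foldl_distinct {γ δ : Type} (row : γ → δ) (p l : List γ) {step : List γ → γ → List γ}
    (h₁ : ∀ xs x, (∃ y ∈ p ++ xs, row x = row y) → step xs x = xs)
    (h₂ : ∀ xs x, (¬ ∃ y ∈ p ++ xs, row x = row y) → step xs x = xs ++ [x]) {xs : List γ}
    (hxs : ((p ++ xs).map row).Nodup) :
    (((p ++ l.foldl step xs).map row).Nodup ∧ (∀ y ∈ l.foldl step xs, y ∈ xs ∨ y ∈ l) ∧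
      ∀ x ∈ xs, x ∈ l.foldl step xs) ∧
        ∀ x ∈ l, ∃ y ∈ p ++ l.foldl step xs, row x = row y := by
  refine foldl_inv (fun r => ((p ++ r).map row).Nodup ∧ (∀ y ∈ r, y ∈ xs ∨ y ∈ l) ∧
    ∀ x ∈ xs, x ∈ r) (fun x r => ∃ y ∈ p ++ r, row x = row y) ?_ ?_
    ⟨hxs, fun y hy => .inl hy, fun y hy => hy⟩
  · rintro r x hx ⟨hn, hr, hs⟩
    by_cases h : ∃ y ∈ p ++ r, row x = row y
    · rw [h₁ _ _ h]
      exact ⟨⟨hn, hr, hs⟩, h⟩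
    · rw [h₂ _ _ h]
      refine ⟨⟨?_, ?_, ?_⟩, x, by simp, rfl⟩
      · rw [← List.append_assoc, List.map_append, List.nodup_append]
        refine ⟨hn, by simp, ?_⟩
        intro a ha b hb hab
        obtain ⟨y, hy, rfl⟩ := List.mem_map.1 ha
        simp only [List.map_cons, List.map_nil, List.mem_singleton] at hb
        exact h ⟨y, hy, by rw [hab, hb]⟩
      · intro y hy
        rcases List.mem_append.1 hy with hy | hy
        · exact hr y hy
        · obtain rfl : y = x := by simpa using hy
          exact .inr hx
      · exact fun y hy => List.mem_append_left _ (hs y hy)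
  · rintro r x hx y hy - ⟨z, hz, hyz⟩
    by_cases h : ∃ y ∈ p ++ r, row x = row y
    · rw [h₁ _ _ h]
      exact ⟨z, hz, hyz⟩
    · rw [h₂ _ _ h]
      exact ⟨z, by rw [← List.append_assoc]; exact List.mem_append_left _ hz, hyz⟩

/-- The entry of the empty word. -/
def firstEntry (O : Table A k) : Timed (Option (Entry A k)) :=
  findSome (fun x => do
    match x.word with
    | [] => return some x
    | _ :: _ => return none) O.entries

/-- Entries with different rows, other than that of `x₀`. -/
def otherEntries (O : Table A k) (x₀ : Entry A k) : Timed (List (Entry A k)) :=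
  fold (fun xs x => do
    match ← Timed.any (fun y => eqRow x.row y.row) (x₀ :: xs) with
    | true => return xs
    | false => snoc xs x) [] O.entries

/-- The automaton with given entries as states. -/
def conjectureOf (x₀ : Entry A k) (others : List (Entry A k)) : Timed (Conjecture A k) := do
  tick (others.length + 1)
  let state : Fin (others.length + 1) → Entry A k := (x₀ :: others).get
  let step ← tabulate fun i => tabulate fun a : Fin k → A => do
    let r ← findSome (fun p => do
      tick (2 * k)
      return if p.1 = a then some p.2 else none) (state i).succ
    let j ← findSome (fun j => do
      match ← eqRow (r.getD []) (state j).row with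
      | true => return some j
      | false => return none) (List.finRange (others.length + 1))
    tick k
    return j.getD 0
  let accept ← tabulate fun i => do
    tick 1
    return (state i).row.headD false
  return ⟨others.length, step, 0, accept⟩

theorem conjecture_eq (O : Table A k) : conjecture O = (do
    let x₀ ← firstEntry O
    let x₀ : Entry A k := x₀.getD ⟨[], [], []⟩
    let others ← otherEntries O x₀
    conjectureOf x₀ others) := rfl

theorem firstEntry_val (h0 : [] ∈ S) :
    (firstEntry (tableOf T S E)).val = some (entryOf T E []) := by
  have hval : ∀ s : Word A k, ((match (entryOf T E s).word with
      | [] => pure (some (entryOf T E s))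
      | _ :: _ => pure none : Timed (Option (Entry A k)))).val =
      if s = [] then some (entryOf T E []) else none := by
    rintro (_ | ⟨a, s⟩)
    · simp [entryOf]
    · simp [entryOf]
  have hval' : (firstEntry (tableOf T S E)).val =
      S.findSome? fun s => if s = [] then some (entryOf T E []) else none := by
    rw [firstEntry, findSome_val, tableOf, List.findSome?_map]
    exact congrArg (fun g => S.findSome? g) (funext hval)
  rw [hval']
  cases hf : S.findSome? fun s => if s = [] then some (entryOf T E []) else none with
  | none => simpa using List.findSome?_eq_none_iff.1 hf [] h0
  | some x =>
    obtain ⟨s, hs, h⟩ := List.exists_of_findSome?_eq_some hf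
    split_ifs at h with hs
    exact h.symm

theorem otherEntries_spec (O : Table A k) (x₀ : Entry A k) :
    ((x₀ :: (otherEntries O x₀).val).map Entry.row).Nodup ∧
      (∀ y ∈ (otherEntries O x₀).val, y ∈ O.entries) ∧
        ∀ x ∈ O.entries, ∃ y ∈ x₀ :: (otherEntries O x₀).val, x.row = y.row := by
  have h := foldl_distinct Entry.row [x₀] O.entries (xs := [])
    (step := fun xs x => (do
      match ← Timed.any (fun y => eqRow x.row y.row) (x₀ :: xs) with
      | true => return xs
      | false => snoc xs x : Timed (List (Entry A k))).val)
    (by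
      intro xs x h
      have h' : (Timed.any (fun y : Entry A k => eqRow x.row y.row) (x₀ :: xs)).val = true := by
        simpa using h
      simp only [bind_val, h']
      rfl)
    (by
      intro xs x h
      have h' : (Timed.any (fun y : Entry A k => eqRow x.row y.row) (x₀ :: xs)).val = false := by
        simpa using h
      simp only [bind_val, h']
      rfl)
    (by simp)
  rw [← fold_val] at h
  exact ⟨h.1.1, fun y hy => by simpa using h.1.2.1 y hy, h.2⟩

theorem conjecture_val (h0 : [] ∈ S) : (conjecture (tableOf T S E)).val =
    (conjectureOf (entryOf T E []) (otherEntries (tableOf T S E) (entryOf T E [])).val).val := by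
  simp only [conjecture_eq, bind_val]
  rw [firstEntry_val h0]
  rfl

/-- Closedness makes every successor row the row of a state. Transitions are read off at one chosen
accessing sequence per state, so they are well defined without consistency. -/
theorem exists_isConjecture (h0 : [] ∈ S) (hcl : Closed T S E) :
    ∃ σ, IsConjecture T S E (conjecture (tableOf T S E)).val σ := by
  rw [conjecture_val h0]
  obtain ⟨hnd, hsub, hcov⟩ := otherEntries_spec (tableOf T S E) (entryOf T E [])
  generalize (otherEntries (tableOf T S E) (entryOf T E [])).val = others at hnd hsub hcov
  have hst : ∀ i : Fin (others.length + 1), ∃ s ∈ S, (entryOf T E [] :: others).get i =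
      entryOf T E s := by
    intro i
    have := List.get_mem (entryOf T E [] :: others) i
    rcases List.mem_cons.1 this with h | h
    · exact ⟨[], h0, h⟩
    · obtain ⟨s, hs, h⟩ := List.mem_map.1 (hsub _ h)
      exact ⟨s, hs, h.symm⟩
  choose σ hσ hσe using hst
  have hrow : ∀ i : Fin (others.length + 1),
      ((entryOf T E [] :: others).get i).row = rowOf T E (σ i) := fun i => by rw [hσe]; rfl
  refine ⟨σ, hσ, (hrow 0).symm, fun i a => ?_, fun i => ?_, fun i j hij => ?_⟩
  · change Fin (others.length + 1) at i
    have hr : ((entryOf T E [] :: others).get i).succ.findSome? (fun p => if p.1 = a then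
        some p.2 else none) = some (rowOf T E (σ i ++ [a])) := by
      rw [hσe]
      cases hf : (entryOf T E (σ i)).succ.findSome? (fun p => if p.1 = a then
        some p.2 else none) with
      | none =>
        have := List.findSome?_eq_none_iff.1 hf (a, rowOf T E (σ i ++ [a]))
          (List.mem_map.2 ⟨a, mem_letters a, rfl⟩)
        simp at this
      | some r =>
        obtain ⟨p, hp, h⟩ := List.exists_of_findSome?_eq_some hf
        obtain ⟨b, -, rfl⟩ := List.mem_map.1 hp
        split_ifs at h with hb
        simp only at hb
        rw [← h, ← hb]
    obtain ⟨t, ht, hrt⟩ := hcl (σ i) (hσ i) a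
    obtain ⟨y, hy, hty⟩ := hcov (entryOf T E t) (List.mem_map.2 ⟨t, ht, rfl⟩)
    obtain ⟨j, rfl⟩ := List.get_of_mem hy
    have hj : rowOf T E (σ i ++ [a]) = rowOf T E (σ j) := by
      rw [hrt, ← hrow j, ← hty]; rfl
    set g : Fin (others.length + 1) → Option (Fin (others.length + 1)) := fun j =>
      (do
        match ← eqRow (rowOf T E (σ i ++ [a])) ((entryOf T E [] :: others).get j).row with
        | true => return some j
        | false => return none : Timed (Option (Fin (others.length + 1)))).val with hg
    have hgv : ∀ j, g j = if rowOf T E (σ i ++ [a]) = rowOf T E (σ j) then some j else none := by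
      intro j
      simp only [hg, bind_val, eqRow_val, hrow]
      by_cases h : rowOf T E (σ i ++ [a]) = rowOf T E (σ j) <;> simp [h]
    have hstep : (conjectureOf (entryOf T E []) others).val.step i a =
        ((List.finRange (others.length + 1)).findSome? g).getD 0 := by
      simp only [conjectureOf, bind_val, tabulate_val, pure_val, findSome_val, hr]
      rfl
    rw [hstep]
    -- The default state `0` is never used: the state `j` found above matches.
    cases hf : (List.finRange (others.length + 1)).findSome? g with
    | none =>
      have := List.findSome?_eq_none_iff.1 hf j (List.mem_finRange j)
      simp [hgv, hj] at this
    | some j' =>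
      obtain ⟨j₁, -, h⟩ := List.exists_of_findSome?_eq_some hf
      rw [hgv] at h
      split_ifs at h with h'
      obtain rfl : j₁ = j' := by simpa using h
      exact h'.symm
  · exact congrArg (fun r => r.headD false) (hrow i)
  · change Fin (others.length + 1) at i j
    have hij' := (hrow i).trans (Eq.trans hij (hrow j).symm)
    have hi : (i : ℕ) < ((entryOf T E [] :: others).map Entry.row).length := by simp; omega
    have hj : (j : ℕ) < ((entryOf T E [] :: others).map Entry.row).length := by simp; omega
    refine Fin.ext ((hnd.getElem_inj_iff (hi := hi) (hj := hj)).1 ?_)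
    rw [List.getElem_map, List.getElem_map]
    exact hij'

end Learner

section Search

set_option linter.unusedSectionVars false

variable {A : Type} [Fintype A] [DecidableEq A] {k : ℕ+}

/-! ### The search for violations of permutation-completeness -/

variable (M : Conjecture A k) (f : Fin k → Fin k)

/-- The successor with the letter `a` of a pair of states in the product automaton. -/
def pairStep (p : Fin M.size × Fin M.size) (a : Fin k → A) : Fin M.size × Fin M.size :=
  (M.step p.1 fun i => a (f i), M.step p.2 a)

/-- The treatment of the letter `a` at the node `x` in the search. -/
def searchStep (x : Word A k × Fin M.size × Fin M.size)
    (acc : List (Word A k × Fin M.size × Fin M.size)) (a : Fin k → A) :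
    Timed (List (Word A k × Fin M.size × Fin M.size)) := do
  tick (4 * k)
  let p := M.step x.2.1 (fun i => a (f i))
  let q := M.step x.2.2 a
  match ← Timed.any (fun y => do
      tick 2
      return decide (y.2 = (p, q))) acc with
  | true => return acc
  | false =>
    let w ← concat x.1 [a]
    snoc acc (w, p, q)

theorem searchRound_eq (as : List (Fin k → A))
    (vis : List (Word A k × Fin M.size × Fin M.size)) : searchRound M f as vis =
      fold (fun acc x => fold (fun acc' a => searchStep M f x acc' a) acc as) vis vis := rfl

variable {M f}

theorem searchStep_of_mem {x : Word A k × Fin M.size × Fin M.size}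
    {acc : List (Word A k × Fin M.size × Fin M.size)} {a : Fin k → A}
    (h : ∃ y ∈ acc, y.2 = pairStep M f x.2 a) : (searchStep M f x acc a).val = acc := by
  have h' : (Timed.any (fun y : Word A k × Fin M.size × Fin M.size => (do
      tick 2
      return decide (y.2 = (M.step x.2.1 (fun i => a (f i)), M.step x.2.2 a)) : Timed Bool))
      acc).val = true := by
    rw [any_val]
    obtain ⟨y, hy, h⟩ := h
    exact List.any_eq_true.2 ⟨y, hy, decide_eq_true h⟩
  simp only [searchStep, bind_val, h']
  rfl

theorem searchStep_of_notMem {x : Word A k × Fin M.size × Fin M.size}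
    {acc : List (Word A k × Fin M.size × Fin M.size)} {a : Fin k → A}
    (h : ¬ ∃ y ∈ acc, y.2 = pairStep M f x.2 a) :
    (searchStep M f x acc a).val = acc ++ [(x.1 ++ [a], pairStep M f x.2 a)] := by
  have h' : (Timed.any (fun y : Word A k × Fin M.size × Fin M.size => (do
      tick 2
      return decide (y.2 = (M.step x.2.1 (fun i => a (f i)), M.step x.2.2 a)) : Timed Bool))
      acc).val = false := by
    rw [any_val]
    exact List.any_eq_false.2 fun y hy hd => h ⟨y, hy, of_decide_eq_true hd⟩
  simp only [searchStep, bind_val, h']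
  rfl

theorem searchStep_time_le (x : Word A k × Fin M.size × Fin M.size)
    (acc : List (Word A k × Fin M.size × Fin M.size)) (a : Fin k → A) :
    (searchStep M f x acc a).time ≤
      4 * k + (acc.length * 3 + 1 + (k * (x.1.length + 1) + 1 + (acc.length + 1))) := by
  have h := any_time_le (c := 2) (l := acc)
    (f := fun y : Word A k × Fin M.size × Fin M.size => (do
      tick 2
      return decide (y.2 = (M.step x.2.1 (fun i => a (f i)), M.step x.2.2 a)) : Timed Bool))
    (by simp)
  simp only [searchStep, bind_time, tick_time]
  refine Nat.add_le_add_left (Nat.add_le_add h ?_) _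
  split
  · simp
  · simp

variable (M f)

/-- The invariant of the search: the pairs are different, and each is reached by its word, which has
length at most `r`. -/
def SearchInv (r : ℕ) (vis : List (Word A k × Fin M.size × Fin M.size)) : Prop :=
  (∀ y ∈ vis, y.2 = (M.toDFA.eval (permute f y.1), M.toDFA.eval y.1) ∧ y.1.length ≤ r) ∧
    (vis.map Prod.snd).Nodup

variable {M f}

theorem SearchInv.mono {r r' : ℕ} {vis : List (Word A k × Fin M.size × Fin M.size)}
    (h : SearchInv M f r vis) (hr : r ≤ r') : SearchInv M f r' vis :=
  ⟨fun y hy => ⟨(h.1 y hy).1, (h.1 y hy).2.trans hr⟩, h.2⟩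

theorem SearchInv.length_le {r : ℕ} {vis : List (Word A k × Fin M.size × Fin M.size)}
    (h : SearchInv M f r vis) : vis.length ≤ M.size * M.size := by
  simpa using h.2.length_le_card

theorem pairStep_eval (w : Word A k) (a : Fin k → A) :
    pairStep M f (M.toDFA.eval (permute f w), M.toDFA.eval w) a =
      (M.toDFA.eval (permute f (w ++ [a])), M.toDFA.eval (w ++ [a])) := by
  rw [permute, permute, List.map_append, List.map_singleton, DFA.eval_append_singleton,
    DFA.eval_append_singleton]
  rfl

theorem SearchInv.after_searchStep {r : ℕ} {acc : List (Word A k × Fin M.size × Fin M.size)}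
    (h : SearchInv M f (r + 1) acc) {x : Word A k × Fin M.size × Fin M.size}
    (hx : x.2 = (M.toDFA.eval (permute f x.1), M.toDFA.eval x.1) ∧ x.1.length ≤ r)
    (a : Fin k → A) :
    SearchInv M f (r + 1) (searchStep M f x acc a).val ∧ acc <+: (searchStep M f x acc a).val ∧
      ∃ y ∈ (searchStep M f x acc a).val, y.2 = pairStep M f x.2 a := by
  by_cases hm : ∃ y ∈ acc, y.2 = pairStep M f x.2 a
  · rw [searchStep_of_mem hm]
    exact ⟨h, List.prefix_rfl, hm⟩
  · rw [searchStep_of_notMem hm]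
    refine ⟨⟨?_, ?_⟩, List.prefix_append _ _, (x.1 ++ [a], pairStep M f x.2 a), by simp, rfl⟩
    · intro y hy
      rcases List.mem_append.1 hy with hy | hy
      · exact h.1 y hy
      · obtain rfl : y = (x.1 ++ [a], pairStep M f x.2 a) := by simpa using hy
        refine ⟨?_, by simpa using hx.2⟩
        rw [hx.1, pairStep_eval]
    · rw [List.map_append, List.nodup_append]
      refine ⟨h.2, by simp, ?_⟩
      intro p hp q hq hpq
      obtain ⟨y, hy, rfl⟩ := List.mem_map.1 hp
      obtain rfl : q = pairStep M f x.2 a := by simpa using hq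
      exact hm ⟨y, hy, hpq⟩

/-- The outer loop runs over the fixed list `vis` while the accumulator only grows at its end. So
successors found early in a round are kept, and new words are longer by one letter than words of
`vis`. -/
theorem SearchInv.after_searchRound {r : ℕ} {vis : List (Word A k × Fin M.size × Fin M.size)}
    (h : SearchInv M f r vis) (as : List (Fin k → A)) :
    (SearchInv M f (r + 1) (searchRound M f as vis).val ∧ vis <+: (searchRound M f as vis).val) ∧
      ∀ x ∈ vis, ∀ a ∈ as, ∃ y ∈ (searchRound M f as vis).val,
        y.2 = pairStep M f x.2 a := by
  have inner : ∀ x ∈ vis, ∀ acc, SearchInv M f (r + 1) acc →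
      (SearchInv M f (r + 1) (as.foldl (fun acc a => (searchStep M f x acc a).val) acc) ∧
        acc <+: as.foldl (fun acc a => (searchStep M f x acc a).val) acc) ∧
      ∀ a ∈ as, ∃ y ∈ as.foldl (fun acc a => (searchStep M f x acc a).val) acc,
        y.2 = pairStep M f x.2 a := by
    intro x hx acc hacc
    refine foldl_inv (fun b => SearchInv M f (r + 1) b ∧ acc <+: b)
      (fun a b => ∃ y ∈ b, y.2 = pairStep M f x.2 a) ?_ ?_ ⟨hacc, List.prefix_rfl⟩
    · rintro b a - ⟨hb, hp⟩
      obtain ⟨h₁, h₂, h₃⟩ := hb.after_searchStep (h.1 x hx) a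
      exact ⟨⟨h₁, hp.trans h₂⟩, h₃⟩
    · rintro b a - a' - ⟨hb, hp⟩ ⟨y, hy, hya⟩
      exact ⟨y, (hb.after_searchStep (h.1 x hx) a).2.1.subset hy, hya⟩
  rw [searchRound_eq, fold_val]
  simp only [fold_val]
  refine foldl_inv (fun b => SearchInv M f (r + 1) b ∧ vis <+: b)
      (fun (x : Word A k × Fin M.size × Fin M.size) b => ∀ a ∈ as, ∃ y ∈ b,
        y.2 = pairStep M f x.2 a) ?_ ?_
      ⟨h.mono (Nat.le_succ r), List.prefix_rfl⟩
  · rintro b x hx ⟨hb, hp⟩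
    obtain ⟨⟨h₁, h₂⟩, h₃⟩ := inner x hx b hb
    exact ⟨⟨h₁, hp.trans h₂⟩, h₃⟩
  · rintro b x hx x' - ⟨hb, hp⟩ hQ a ha
    obtain ⟨y, hy, hya⟩ := hQ a ha
    exact ⟨y, (inner x hx b hb).1.2.subset hy, hya⟩

theorem SearchInv.searchRound_time_le {B r : ℕ}
    {vis : List (Word A k × Fin M.size × Fin M.size)} (h : SearchInv M f r vis)
    {as : List (Fin k → A)} (hB : 4 ≤ B) (hk : (k : ℕ) ≤ B) (hM : M.size ≤ B)
    (has : as.length ≤ B) (hr : r ≤ B ^ 2) : (searchRound M f as vis).time ≤ B ^ 24 := by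
  have hB2 : 2 ≤ B := by omega
  have hlen : ∀ {r'} {acc : List (Word A k × Fin M.size × Fin M.size)},
      SearchInv M f r' acc → acc.length ≤ B ^ 2 := fun h =>
    h.length_le.trans (by rw [pow_two]; exact Nat.mul_le_mul hM hM)
  have inner : ∀ x ∈ vis, ∀ acc, SearchInv M f (r + 1) acc →
      SearchInv M f (r + 1) (fold (fun acc a => searchStep M f x acc a) acc as).val ∧
      (fold (fun acc a => searchStep M f x acc a) acc as).time ≤ B ^ 20 := by
    intro x hx acc hacc
    have hstep : ∀ b a, SearchInv M f (r + 1) b →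
        SearchInv M f (r + 1) (searchStep M f x b a).val ∧
          (searchStep M f x b a).time ≤ B ^ 17 := by
      intro b a hb
      refine ⟨(hb.after_searchStep (h.1 x hx) a).1, (searchStep_time_le x b a).trans ?_⟩
      have hb' := hlen hb
      have hx' := (h.1 x hx).2.trans hr
      have h3 : 3 ≤ B ^ 1 := by rw [pow_one]; omega
      have h4 : 4 ≤ B ^ 1 := by rw [pow_one]; omega
      exact le_pow_of_le hB2 (add_le_pow hB2 (mul_le_pow h4 (le_pow_one hk))
        (add_le_pow hB2 (add_le_pow hB2 (mul_le_pow hb' h3) one_le_pow_zero)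
          (add_le_pow hB2 (add_le_pow hB2 (mul_le_pow (le_pow_one hk)
            (add_le_pow hB2 hx' one_le_pow_zero)) one_le_pow_zero)
            (add_le_pow hB2 hb' one_le_pow_zero)))) (by norm_num)
    obtain ⟨h₁, h₂⟩ := fold_spec (f := fun acc a => searchStep M f x acc a)
      (c := B ^ 17) (fun _ b => SearchInv M f (r + 1) b) (l := as)
      (fun _ b a _ _ hb => hstep b a hb) hacc
    exact ⟨h₁, le_pow_of_le hB2 (h₂.trans (loop_le_pow hB2 (le_pow_one has) le_rfl))
      (by norm_num)⟩
  rw [searchRound_eq]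
  refine le_pow_of_le hB2 ((fold_spec (f := fun acc x => fold (fun acc' a =>
    searchStep M f x acc' a) acc as) (c := B ^ 20)
    (fun _ b => SearchInv M f (r + 1) b) (l := vis) (fun i b x hx _ hb => inner x hx b hb)
    (h.mono (Nat.le_succ r))).2.trans
    (loop_le_pow hB2 (hlen h) le_rfl)) (by norm_num)

theorem search_succ_val (as : List (Fin k → A)) (n : ℕ)
    (vis : List (Word A k × Fin M.size × Fin M.size)) : (search M f as (n + 1) vis).val =
      (search M f as n (searchRound M f as vis).val).val := rfl

theorem search_succ_time (as : List (Fin k → A)) (n : ℕ)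
    (vis : List (Word A k × Fin M.size × Fin M.size)) : (search M f as (n + 1) vis).time =
      1 + ((searchRound M f as vis).time +
        (search M f as n (searchRound M f as vis).val).time) := rfl

theorem SearchInv.after_search {r : ℕ} {vis : List (Word A k × Fin M.size × Fin M.size)}
    (h : SearchInv M f r vis) (as : List (Fin k → A)) (n : ℕ) :
    SearchInv M f (r + n) (search M f as n vis).val ∧ vis <+: (search M f as n vis).val := by
  induction n generalizing r vis with
  | zero => exact ⟨h, List.prefix_rfl⟩
  | succ n ih =>
    obtain ⟨⟨h₁, h₂⟩, -⟩ := h.after_searchRound as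
    obtain ⟨h₃, h₄⟩ := ih h₁
    rw [search_succ_val]
    exact ⟨h₃.mono (by omega), h₂.trans h₄⟩

theorem SearchInv.search_time_le {B r : ℕ}
    {vis : List (Word A k × Fin M.size × Fin M.size)} (h : SearchInv M f r vis)
    {as : List (Fin k → A)} (hB : 4 ≤ B) (hk : (k : ℕ) ≤ B) (hM : M.size ≤ B)
    (has : as.length ≤ B) {n : ℕ} (hr : r + n ≤ B ^ 2) :
    (search M f as n vis).time ≤ n * (B ^ 24 + 1) + 1 := by
  induction n generalizing r vis with
  | zero => simp [search]
  | succ n ih =>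
    have h₁ := h.searchRound_time_le hB hk hM has (by omega)
    have h₂ := ih (h.after_searchRound as).1.1 (by omega)
    rw [search_succ_time]
    linarith

theorem search_eq_self {as : List (Fin k → A)} {vis : List (Word A k × Fin M.size × Fin M.size)}
    (h : (searchRound M f as vis).val = vis) (n : ℕ) : (search M f as n vis).val = vis := by
  induction n with
  | zero => rfl
  | succ n ih => rw [search_succ_val, h, ih]

/-- After sufficiently many rounds, the visited pairs are closed under transitions. -/
theorem SearchInv.search_closed {r : ℕ} {vis : List (Word A k × Fin M.size × Fin M.size)}
    (h : SearchInv M f r vis) (as : List (Fin k → A)) {n : ℕ}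
    (hn : M.size * M.size < vis.length + n) :
    ∀ x ∈ (search M f as n vis).val, ∀ a ∈ as, ∃ y ∈ (search M f as n vis).val,
      y.2 = pairStep M f x.2 a := by
  induction n generalizing r vis with
  | zero => exact absurd h.length_le (by omega)
  | succ n ih =>
    obtain ⟨⟨h₁, h₂⟩, h₃⟩ := h.after_searchRound as
    -- A growing list can grow only until all `M.size * M.size` pairs are present; a round that adds
    -- nothing shows closedness and changes nothing afterwards.
    by_cases hlt : vis.length < (searchRound M f as vis).val.length
    · exact ih h₁ (by omega)
    · have heq := h₂.eq_of_length_le (not_lt.1 hlt)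
      rw [search_succ_val, ← heq, search_eq_self heq.symm]
      rwa [← heq] at h₃

theorem searchInv_start : SearchInv M f 0 [([], M.start, M.start)] := by
  refine ⟨fun y hy => ?_, by simp⟩
  obtain rfl : y = ([], M.start, M.start) := by simpa using hy
  exact ⟨rfl, le_rfl⟩

theorem incompleteness_val : (incompleteness M).val =
    (tuples (List.finRange k) k).val.findSome? fun f =>
      (search M f (letters A k).val (M.size * M.size) [([], M.start, M.start)]).val.findSome?
        fun x => if M.accept x.2.1 = true ∧ M.accept x.2.2 = false then some x.1 else none := by
  simp [incompleteness]

theorem exists_of_incompleteness {w : Word A k} (h : (incompleteness M).val = some w) :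
    ∃ f : Fin k → Fin k, permute f w ∈ M.toDFA.accepts ∧ w ∉ M.toDFA.accepts ∧
      w.length ≤ M.size * M.size := by
  rw [incompleteness_val] at h
  obtain ⟨f, -, h⟩ := List.exists_of_findSome?_eq_some h
  obtain ⟨x, hx, h⟩ := List.exists_of_findSome?_eq_some h
  split_ifs at h with hacc
  obtain rfl : x.1 = w := by simpa using h
  obtain ⟨h₁, h₂⟩ := (searchInv_start.after_search (letters A k).val (M.size * M.size)).1.1 x hx
  rw [h₁] at hacc
  refine ⟨f, hacc.1, fun hw => ?_, by simpa using h₂⟩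
  have : M.accept (M.toDFA.eval x.1) = true := hw
  rw [hacc.2] at this
  simp at this

/-- The visited pairs contain the start and are closed under transitions, so every word leads to a
visited pair. Acceptance of both words depends on that pair alone, whichever word the search stored
with it. -/
theorem permute_closed_of_incompleteness (h : (incompleteness M).val = none)
    (f : Fin k → Fin k) (w : Word A k) (hw : permute f w ∈ M.toDFA.accepts) :
    w ∈ M.toDFA.accepts := by
  rw [incompleteness_val, List.findSome?_eq_none_iff] at h
  have h := List.findSome?_eq_none_iff.1 (h f (mem_tuples fun _ => List.mem_finRange _))
  -- The starting list has one element, so `M.size * M.size` rounds suffice.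
  have hcl := (searchInv_start (M := M) (f := f)).search_closed (letters A k).val
    (n := M.size * M.size) (by simp)
  have hpre := ((searchInv_start (M := M) (f := f)).after_search (letters A k).val
    (M.size * M.size)).2
  generalize (search M f (letters A k).val (M.size * M.size) [([], M.start, M.start)]).val = vis
    at h hcl hpre
  have hreach : ∀ w : Word A k, ∃ y ∈ vis,
      y.2 = (M.toDFA.eval (permute f w), M.toDFA.eval w) := by
    intro w
    induction w using List.reverseRecOn with
    | nil => exact ⟨([], M.start, M.start), hpre.subset (by simp), rfl⟩
    | append_singleton w a ih =>
      obtain ⟨y, hy, hyw⟩ := ih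
      obtain ⟨z, hz, hzy⟩ := hcl y hy a (mem_letters a)
      exact ⟨z, hz, by rw [hzy, hyw, pairStep_eval]⟩
  obtain ⟨y, hy, hyw⟩ := hreach w
  have h := h y hy
  by_contra hn
  rw [hyw, if_pos ⟨hw, by simpa using (fun h' => hn h' : ¬ M.accept (M.toDFA.eval w) = true)⟩] at h
  simp at h

/-! ### Running time of the permutation-completeness check -/

theorem letters_time_le {B : ℕ} (hB : 2 ≤ B) (hk : (k : ℕ) ≤ B)
    (hA : (Fintype.card A + 1) ^ (k : ℕ) ≤ B) : (letters A k).time ≤ B ^ 11 :=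
  tuples_time_le hB hk (by simpa using hA)

theorem length_letters_le {B : ℕ} (hA : (Fintype.card A + 1) ^ (k : ℕ) ≤ B) :
    (letters A k).val.length ≤ B := by
  rw [length_letters]
  exact (Nat.pow_le_pow_left (Nat.le_succ _) _).trans hA

theorem incompleteness_time_le {B : ℕ} (hB : 4 ≤ B) (hk : (k : ℕ) ≤ B)
    (hA : (Fintype.card A + 1) ^ (k : ℕ) ≤ B) (hkk : ((k : ℕ) + 1) ^ (k : ℕ) ≤ B)
    (hM : M.size ≤ B) : (incompleteness M).time ≤ B ^ 70 := by
  have hB2 : 2 ≤ B := by omega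
  have hMM : M.size * M.size ≤ B ^ 2 := by rw [pow_two]; exact Nat.mul_le_mul hM hM
  have h₁ := letters_time_le (A := A) hB2 hk hA
  have h₂ : (tuples (List.finRange k) k).time ≤ B ^ 11 :=
    tuples_time_le hB2 hk (by simpa using hkk)
  have h₃ : (tuples (List.finRange k) k).val.length ≤ B ^ 1 := by
    rw [length_tuples, pow_one, List.length_finRange]
    exact (Nat.pow_le_pow_left (Nat.le_succ _) _).trans hkk
  have h3 : 2 ≤ B ^ 1 := by rw [pow_one]; omega
  simp only [incompleteness, bind_time]
  refine le_pow_of_le hB2 (add_le_pow hB2 h₁ (add_le_pow hB2 h₂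
    ((findSome_time_le (c := B ^ 40) fun f _ => ?_).trans (loop_le_pow hB2 h₃ le_rfl))))
    (by norm_num)
  have h₄ := (searchInv_start (M := M) (f := f)).search_time_le hB hk hM
    (length_letters_le hA) (n := M.size * M.size) (by simpa using hMM)
  have h₅ := ((searchInv_start (M := M) (f := f)).after_search (letters A k).val
    (M.size * M.size)).1.length_le.trans hMM
  simp only [bind_time]
  refine le_pow_of_le hB2 (add_le_pow hB2 (h₄.trans (loop_le_pow hB2 hMM le_rfl))
    ((findSome_time_le (c := 2) fun x _ => ?_).trans (loop_le_pow hB2 h₅ h3))) (by norm_num)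
  simp

end Search

section Learner

set_option linter.unusedSectionVars false

variable {A : Type} [Fintype A] [DecidableEq A] {k : ℕ+} {T : Teacher A} {S E : List (Word A k)}

/-! ### Amended and extended tables -/

/-- Only membership and the number of accessing sequences matter later, so the order of the new list
is left open. -/
theorem amend_spec (w : Word A k) : ∃ S' : List (Word A k),
    (amend T (tableOf T S E) w).val = tableOf T S' E ∧ (∀ s, s ∈ S' ↔ s ∈ S ∨ s <+: w) ∧
      S'.length ≤ S.length + (w.length + 1) := by
  let step : List (Word A k) → Word A k → Timed (List (Word A k)) := fun S v => do
    match ← Timed.any (fun s => eqWord s v) S with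
    | true => return S
    | false => snoc S v
  have hstep : ∀ S v, (step S v).val = if v ∈ S then S else S ++ [v] := by
    intro S v
    by_cases h : v ∈ S
    · have h' : (Timed.any (fun s => eqWord s v) S).val = true := by simpa using h
      simp only [step, bind_val, h', if_pos h]
      rfl
    · have h' : (Timed.any (fun s => eqWord s v) S).val = false := by
        simp only [any_val, eqWord_val, List.any_eq_false, decide_eq_true_eq]
        rintro s hs rfl
        exact h hs
      simp only [step, bind_val, h', if_neg h]
      rfl
  refine ⟨(fold step S w.inits).val, ?_, ?_, ?_⟩
  · simp only [amend, bind_val, accessing_val, fill_val]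
    rfl
  · rw [fold_val]
    simp only [hstep]
    obtain ⟨⟨h₁, h₂⟩, h₃⟩ := foldl_inv (step := fun S v => if v ∈ S then S else S ++ [v])
      (l := w.inits) (b := S) (fun S' => (∀ s ∈ S, s ∈ S') ∧ ∀ s ∈ S', s ∈ S ∨ s ∈ w.inits)
      (fun v S' => v ∈ S')
      (by
        rintro S' v hv ⟨h₁, h₂⟩
        by_cases h : v ∈ S'
        · simp only [if_pos h]
          exact ⟨⟨h₁, h₂⟩, h⟩
        · simp only [if_neg h]
          refine ⟨⟨fun s hs => List.mem_append_left _ (h₁ s hs), fun s hs => ?_⟩, by simp⟩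
          rcases List.mem_append.1 hs with hs | hs
          · exact h₂ s hs
          · exact .inr ((List.mem_singleton.1 hs) ▸ hv))
      (by
        rintro S' v - v' - - hv'
        by_cases h : v ∈ S'
        · simpa only [if_pos h] using hv'
        · simp only [if_neg h]
          exact List.mem_append_left _ hv')
      ⟨fun s hs => hs, fun s hs => .inl hs⟩
    intro s
    constructor
    · intro hs
      simpa using h₂ s hs
    · rintro (hs | hs)
      · exact h₁ s hs
      · exact h₃ s ((List.mem_inits s w).2 hs)
  · have key : ∀ (l : List (Word A k)) (S : List (Word A k)),
        (fold step S l).val.length ≤ S.length + l.length := by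
      intro l
      induction l with
      | nil => intro S; simp
      | cons v l ih =>
        intro S
        rw [fold_val, List.foldl_cons, ← fold_val, hstep]
        refine (ih _).trans ?_
        split_ifs
        · simp
        · simp; omega
    simpa using key w.inits S

theorem extendTable_val (c : ℕ+) : (extendTable T c (tableOf T S E)).val =
    tableOf T (S.map fun s => s.map (extendLetter c)) (E.map fun e => e.map (extendLetter c)) := by
  simp only [extendTable, bind_val, accessing_val, fill_val, map_val]
  rfl

/-! ### Times of the parts of the learner -/

/-- `B` bounds the parameters of the learner for the arity `k`. -/
structure Dominates (A : Type) [Fintype A] (k : ℕ+) (B : ℕ) : Prop where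
  four_le : 4 ≤ B
  arity_le : (k : ℕ) ≤ B
  letters_le : (Fintype.card A + 1) ^ (k : ℕ) ≤ B
  maps_le : ((k : ℕ) + 1) ^ (k : ℕ) ≤ B

theorem Dominates.two_le {B : ℕ} (h : Dominates A k B) : 2 ≤ B := by have := h.four_le; omega

/-- The numbers and lengths of accessing and separating sequences are at most `X`. -/
structure Sized (S E : List (Word A k)) (X : ℕ) : Prop where
  length_S : S.length ≤ X
  length_E : E.length ≤ X
  word_S : ∀ s ∈ S, s.length ≤ X
  word_E : ∀ e ∈ E, e.length ≤ X

theorem Sized.mono {X Y : ℕ} (h : Sized S E X) (hXY : X ≤ Y) : Sized S E Y :=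
  ⟨h.1.trans hXY, h.2.trans hXY, fun s hs => (h.3 s hs).trans hXY,
    fun e he => (h.4 e he).trans hXY⟩

variable {B : ℕ}

/-- The length bound is `B ^ 2` instead of `B` to cover the words `s ++ [a]`, which may have length
`B + 1`. -/
theorem askRow_time_le (hB : Dominates A k B) (h : Sized S E B) {w : Word A k}
    (hw : w.length ≤ B ^ 2) : (askRow T E w).time ≤ B ^ 16 := by
  have h2 := hB.two_le
  refine le_pow_of_le h2 ((map_time_le (c := B ^ 13) fun e he => ?_).trans
    (loop_le_pow h2 (le_pow_one h.length_E) le_rfl)) (by norm_num)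
  have hc : k * (w.length + e.length) + 1 ≤ B ^ 6 := le_pow_of_le h2
    (add_le_pow h2 (mul_le_pow (le_pow_one hB.arity_le)
      (add_le_pow h2 hw (le_pow_one (h.word_E e he)))) one_le_pow_zero) (by norm_num)
  simp only [bind_time, concat_time, concat_val, ask_time, List.length_append]
  exact add_le_pow h2 hc hc

theorem fill_time_le (hB : Dominates A k B) (h : Sized S E B) :
    (fill T S E).time ≤ B ^ 56 := by
  have h2 := hB.two_le
  simp only [fill, bind_time, pure_time, add_zero]
  refine le_pow_of_le h2 (add_le_pow h2 (letters_time_le h2 hB.arity_le hB.letters_le)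
    ((map_time_le (c := B ^ 41) fun s hs => ?_).trans
      (loop_le_pow h2 (le_pow_one h.length_S) le_rfl))) (by norm_num)
  have hs := h.word_S s hs
  refine le_pow_of_le h2 (add_le_pow h2 (askRow_time_le hB h
    (le_pow_of_le h2 (le_pow_one hs) (by norm_num)))
    ((map_time_le (c := B ^ 21) fun a _ => ?_).trans
      (loop_le_pow h2 (le_pow_one (length_letters_le hB.letters_le)) le_rfl))) (by norm_num)
  simp only [bind_time, pure_time, add_zero, concat_time, List.length_singleton]
  refine le_pow_of_le h2 (add_le_pow h2 (add_le_pow h2 (mul_le_pow (le_pow_one hB.arity_le)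
    (add_le_pow h2 (le_pow_one hs) one_le_pow_zero)) one_le_pow_zero)
    (askRow_time_le hB h ?_)) (by norm_num)
  simpa using add_le_pow h2 (le_pow_one hs) one_le_pow_zero

theorem accessing_time_le (h2 : 2 ≤ B) (h : Sized S E B) :
    (accessing (tableOf T S E)).time ≤ B ^ 3 := by
  refine (map_time_le (c := 1) fun x _ => ?_).trans
    (loop_le_pow h2 (a := 1) ?_ one_le_pow_zero)
  · simp
  · simpa [tableOf] using h.length_S

theorem eqRow_time_le (h2 : 2 ≤ B) {r r' : List Bool} (h : r.length ≤ B) (h' : r'.length ≤ B) :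
    (eqRow r r').time ≤ B ^ 4 :=
  add_le_pow h2 (add_le_pow h2 (le_pow_one h) (le_pow_one h')) one_le_pow_zero

theorem concat_time_le (hB : Dominates A k B) {w w' : Word A k} (h : w.length ≤ B)
    (h' : w'.length ≤ B) : (concat w w').time ≤ B ^ 5 :=
  add_le_pow hB.two_le (mul_le_pow (le_pow_one hB.arity_le)
    (add_le_pow hB.two_le (le_pow_one h) (le_pow_one h'))) one_le_pow_zero

theorem length_row_of_mem {x : Entry A k} (hx : x ∈ (tableOf T S E).entries) :
    x.row.length = E.length := by
  obtain ⟨s, -, rfl⟩ := List.mem_map.1 hx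
  simp [entryOf, rowOf]

theorem length_word_le_of_mem (h : Sized S E B) {x : Entry A k}
    (hx : x ∈ (tableOf T S E).entries) : x.word.length ≤ B := by
  obtain ⟨s, hs, rfl⟩ := List.mem_map.1 hx
  exact h.word_S s hs

theorem length_succ_le_of_mem (hB : Dominates A k B) {x : Entry A k}
    (hx : x ∈ (tableOf T S E).entries) : x.succ.length ≤ B := by
  obtain ⟨s, -, rfl⟩ := List.mem_map.1 hx
  simpa [entryOf] using length_letters_le hB.letters_le

theorem length_of_mem_succ {x : Entry A k} (hx : x ∈ (tableOf T S E).entries)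
    {p : (Fin k → A) × List Bool} (hp : p ∈ x.succ) : p.2.length = E.length := by
  obtain ⟨s, -, rfl⟩ := List.mem_map.1 hx
  obtain ⟨a, -, rfl⟩ := List.mem_map.1 hp
  simp [rowOf]

theorem length_entries_le (h : Sized S E B) : (tableOf T S E).entries.length ≤ B := by
  simpa [tableOf] using h.length_S

theorem inconsistency_time_le (hB : Dominates A k B) (h : Sized S E B) :
    (inconsistency (tableOf T S E)).time ≤ B ^ 22 := by
  have h2 := hB.two_le
  refine (findSome_time_le (c := B ^ 19) fun x hx => ?_).trans
    (loop_le_pow h2 (le_pow_one (length_entries_le h)) le_rfl)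
  refine (findSome_time_le (c := B ^ 16) fun y hy => ?_).trans
    (loop_le_pow h2 (le_pow_one (length_entries_le h)) le_rfl)
  rw [bind_time]
  refine add_le_pow h2 (eqRow_time_le h2 (length_row_of_mem hx ▸ h.length_E)
    (length_row_of_mem hy ▸ h.length_E)) (b := 11) ?_
  split
  · simp
  refine (findSome_time_le (c := B ^ 8) fun p _ => ?_).trans
    (loop_le_pow h2 (le_pow_one ?_) le_rfl)
  · refine (findSome_time_le (c := B ^ 5) fun q hq => ?_).trans
      (loop_le_pow h2 (le_pow_one ?_) le_rfl)
    · split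
      · simp
      · simp only [bind_time, pure_time, add_zero]
        exact concat_time_le hB (by simp; omega) (h.word_E _ (List.of_mem_zip hq).1)
    · rw [List.length_zip]
      exact (min_le_left _ _).trans h.length_E
  · rw [List.length_zip]
    exact (min_le_left _ _).trans (length_succ_le_of_mem hB hx)

theorem unclosed_time_le (hB : Dominates A k B) (h : Sized S E B) :
    (unclosed (tableOf T S E)).time ≤ B ^ 19 := by
  have h2 := hB.two_le
  refine (findSome_time_le (c := B ^ 16) fun x hx => ?_).trans
    (loop_le_pow h2 (le_pow_one (length_entries_le h)) le_rfl)
  refine (findSome_time_le (c := B ^ 13) fun p hp => ?_).trans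
    (loop_le_pow h2 (le_pow_one (length_succ_le_of_mem hB hx)) le_rfl)
  rw [bind_time]
  refine add_le_pow h2 (a := 7) (b := 5) ?_ ?_
  · exact (any_time_le (c := B ^ 4) fun y hy => eqRow_time_le h2
      (length_of_mem_succ hx hp ▸ h.length_E) (length_row_of_mem hy ▸ h.length_E)).trans
      (loop_le_pow h2 (le_pow_one (length_entries_le h)) le_rfl)
  · split
    · simp
    · simp only [bind_time, pure_time, add_zero]
      exact concat_time_le hB (length_word_le_of_mem h hx) (by simp; omega)

theorem firstEntry_time_le (hB : Dominates A k B) (h : Sized S E B) :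
    (firstEntry (tableOf T S E)).time ≤ B ^ 3 := by
  refine (findSome_time_le (c := 1) fun x _ => ?_).trans
    (loop_le_pow hB.two_le (le_pow_one (length_entries_le h)) one_le_pow_zero)
  split <;> simp

theorem otherEntries_spec_time (hB : Dominates A k B) (h : Sized S E B) {x₀ : Entry A k}
    (hx₀ : x₀ ∈ (tableOf T S E).entries) :
    (otherEntries (tableOf T S E) x₀).val.length ≤ B ∧
      (otherEntries (tableOf T S E) x₀).time ≤ B ^ 14 := by
  have h2 := hB.two_le
  have hlen := length_entries_le (T := T) h
  obtain ⟨h₁, h₂⟩ := fold_spec (c := B ^ 11) (l := (tableOf T S E).entries) (b := [])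
    (f := fun xs x => (do
      match ← Timed.any (fun y => eqRow x.row y.row) (x₀ :: xs) with
      | true => return xs
      | false => snoc xs x : Timed (List (Entry A k))))
    -- Counting rounds bounds the number of chosen entries by that of all entries.
    (fun i xs => xs.length ≤ i ∧ ∀ y ∈ xs, y ∈ (tableOf T S E).entries)
    (by
      rintro i xs x hx hi ⟨hl, hxs⟩
      constructor
      · simp only [bind_val]
        split
        · exact ⟨hl.trans (Nat.le_succ i), hxs⟩
        · refine ⟨by simpa using hl, fun y hy => ?_⟩
          rcases List.mem_append.1 hy with hy | hy
          · exact hxs y hy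
          · exact (List.mem_singleton.1 hy) ▸ hx
      · rw [bind_time]
        have hl' : xs.length + 1 ≤ B ^ 2 :=
          add_le_pow h2 (le_pow_one (by omega : xs.length ≤ B)) one_le_pow_zero
        refine add_le_pow h2 (a := 8) (b := 2) ?_ ?_
        · refine (any_time_le (c := B ^ 4) fun y hy => eqRow_time_le h2
            (length_row_of_mem hx ▸ h.length_E) ?_).trans (loop_le_pow h2 hl' le_rfl)
          rcases List.mem_cons.1 hy with rfl | hy
          · exact length_row_of_mem hx₀ ▸ h.length_E
          · exact length_row_of_mem (hxs y hy) ▸ h.length_E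
        · split
          · simp
          · exact hl')
    ⟨le_rfl, by simp⟩
  exact ⟨h₁.1.trans hlen, h₂.trans (loop_le_pow h2 (le_pow_one hlen) le_rfl)⟩

theorem conjectureOf_time_le (hB : Dominates A k B) (h : Sized S E B) {x₀ : Entry A k}
    {others : List (Entry A k)} (hmem : ∀ x ∈ x₀ :: others, x ∈ (tableOf T S E).entries)
    (hlen : others.length ≤ B) : (conjectureOf x₀ others).time ≤ B ^ 35 := by
  have h2 := hB.two_le
  have hlen' : others.length + 1 ≤ B ^ 2 := add_le_pow h2 (le_pow_one hlen) one_le_pow_zero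
  have hcard : Fintype.card (Fin (others.length + 1)) ≤ B ^ 2 := by simpa using hlen'
  have hcardA : Fintype.card (Fin k → A) ≤ B ^ 1 := by
    rw [Fintype.card_fun, Fintype.card_fin, pow_one, ← length_letters]
    exact length_letters_le hB.letters_le
  have hst : ∀ i : Fin (others.length + 1), (x₀ :: others).get i ∈ (tableOf T S E).entries :=
    fun i => hmem _ (List.get_mem _ _)
  simp only [conjectureOf, bind_time, tick_time, pure_time, add_zero]
  refine le_pow_of_le h2 (add_le_pow h2 hlen' (add_le_pow h2
    ((tabulate_time_le (c := B ^ 20) fun i => ?_).trans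
      (mul_le_pow hcard (add_le_pow h2 le_rfl one_le_pow_zero)))
    ((tabulate_time_le (c := 1) fun i => ?_).trans
      (mul_le_pow hcard (add_le_pow h2 one_le_pow_zero one_le_pow_zero))))) (by norm_num)
  · refine le_pow_of_le h2 ((tabulate_time_le (c := B ^ 16) fun a => ?_).trans
      (mul_le_pow hcardA (add_le_pow h2 le_rfl one_le_pow_zero))) (by norm_num)
    simp only [bind_time, tick_time, pure_time, add_zero]
    refine le_pow_of_le h2 (add_le_pow h2 (a := 5) ?_
      (add_le_pow h2 (a := 8) ?_ (le_pow_one hB.arity_le))) (by norm_num)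
    · exact (findSome_time_le (c := 2 * k) fun p _ => by simp).trans
        (loop_le_pow h2 (le_pow_one (length_succ_le_of_mem hB (hst i)))
          (mul_le_pow (le_pow_one h2) (le_pow_one hB.arity_le)))
    · refine (findSome_time_le (c := B ^ 4) fun j _ => ?_).trans
        (loop_le_pow h2 (by simpa using hlen') le_rfl)
      have ht : ∀ x : Timed Bool, (match x.val with
          | true => (pure (some j) : Timed (Option (Fin (others.length + 1))))
          | false => pure none).time = 0 := by
        intro x
        split <;> rfl
      have hr : ((findSome (fun p : (Fin k → A) × List Bool => (do
          tick (2 * k)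
          return if p.1 = a then some p.2 else none : Timed (Option (List Bool))))
          ((x₀ :: others).get i).succ).val.getD []).length ≤ B := by
        rw [findSome_val]
        cases hf : ((x₀ :: others).get i).succ.findSome? _ with
        | none => simp
        | some r =>
          obtain ⟨p, hp, h'⟩ := List.exists_of_findSome?_eq_some hf
          simp only [bind_val, pure_val] at h'
          split_ifs at h' with hpa
          obtain rfl : p.2 = r := by simpa using h'
          exact length_of_mem_succ (hst i) hp ▸ h.length_E
      refine le_trans (le_of_eq ?_) (eqRow_time_le h2 hr
        (length_row_of_mem (hst j) ▸ h.length_E))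
      exact congrArg _ (ht _)
  · simp

theorem entryOf_mem {s : Word A k} (hs : s ∈ S) : entryOf T E s ∈ (tableOf T S E).entries :=
  List.mem_map.2 ⟨s, hs, rfl⟩

theorem conjecture_time_le (hB : Dominates A k B) (h : Sized S E B) (h0 : [] ∈ S) :
    (conjecture (tableOf T S E)).time ≤ B ^ 54 := by
  have h2 := hB.two_le
  simp only [conjecture_eq, bind_time]
  rw [firstEntry_val h0]
  obtain ⟨h₁, h₂⟩ := otherEntries_spec_time hB h (entryOf_mem (T := T) (E := E) h0)
  refine add_le_pow h2 (firstEntry_time_le hB h) (add_le_pow h2 h₂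
    (conjectureOf_time_le (T := T) hB h ?_ h₁))
  intro x hx
  rcases List.mem_cons.1 hx with rfl | hx
  · exact entryOf_mem h0
  · exact (otherEntries_spec _ _).2.1 x hx

theorem amend_time_le (hB : Dominates A k B) (h : Sized S E B) {w : Word A k}
    (hw : S.length + (w.length + 1) ≤ B) : (amend T (tableOf T S E) w).time ≤ B ^ 90 := by
  have h2 := hB.two_le
  have hwB : w.length ≤ B := by omega
  obtain ⟨⟨h₁, h₂⟩, h₃⟩ := fold_spec (c := B ^ 11) (l := w.inits) (b := S)
    (f := fun S v => (do
      match ← Timed.any (fun s => eqWord s v) S with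
      | true => return S
      | false => snoc S v : Timed (List (Word A k))))
    (fun i S' => S'.length ≤ S.length + i ∧ ∀ s ∈ S', s.length ≤ B)
    (by
      rintro i S' v hv hi ⟨hl, hs⟩
      have hv' : v.length ≤ B := ((List.mem_inits v w).1 hv).length_le.trans hwB
      have hi' : i < w.length + 1 := by simpa using hi
      have hl' : S'.length + 1 ≤ B := by omega
      constructor
      · simp only [bind_val]
        split
        · exact ⟨by simp only [pure_val]; omega, hs⟩
        · refine ⟨by simp; omega, fun s hs' => ?_⟩
          rcases List.mem_append.1 hs' with hs' | hs'
          · exact hs s hs'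
          · exact (List.mem_singleton.1 hs') ▸ hv'
      · rw [bind_time]
        refine le_pow_of_le h2 (add_le_pow h2 (a := 8) (b := 1) ?_ ?_) (by norm_num)
        -- `eqWord` and `concat` take the same number of steps.
        · exact (any_time_le (c := B ^ 5) fun s hs' => concat_time_le hB (hs s hs') hv').trans
            (loop_le_pow h2 (le_pow_one (by omega)) le_rfl)
        · split
          · simp
          · simpa using hl')
    ⟨le_rfl, h.word_S⟩
  rw [List.length_inits] at h₁ h₃
  have hS' : Sized (fold (fun S v => (do
      match ← Timed.any (fun s => eqWord s v) S with
      | true => return S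
      | false => snoc S v : Timed (List (Word A k)))) S w.inits).val E B :=
    ⟨h₁.trans hw, h.length_E, h₂, h.word_E⟩
  simp only [amend, bind_time, accessing_val, tick_time]
  refine le_pow_of_le h2 (add_le_pow h2 (accessing_time_le h2 h) (add_le_pow h2
    (mul_le_pow (le_pow_one (by omega : w.length + 1 ≤ B)) (add_le_pow h2
      (mul_le_pow (le_pow_one hB.arity_le) (le_pow_one hwB)) one_le_pow_zero))
    (add_le_pow h2 (h₃.trans (loop_le_pow h2 (le_pow_one (by omega : w.length + 1 ≤ B)) le_rfl))
      (fill_time_le (T := T) hB hS')))) (by norm_num)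

theorem extend_time_le {c : ℕ+} (hB : Dominates A c B) {w : Word A k} (hw : w.length ≤ B) :
    (extend c w).time ≤ B ^ 3 := by
  simp only [extend, bind_time, tick_time, pure_time, add_zero]
  exact add_le_pow hB.two_le (mul_le_pow (le_pow_one hB.arity_le) (le_pow_one hw)) one_le_pow_zero

theorem Sized.extend {X : ℕ} (h : Sized S E X) (c : ℕ+) :
    Sized (S.map fun s => s.map (extendLetter c)) (E.map fun e => e.map (extendLetter c)) X := by
  refine ⟨by simpa using h.length_S, by simpa using h.length_E, ?_, ?_⟩
  · intro s hs
    obtain ⟨s, hs', rfl⟩ := List.mem_map.1 hs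
    simpa using h.word_S s hs'
  · intro s hs
    obtain ⟨s, hs', rfl⟩ := List.mem_map.1 hs
    simpa using h.word_E s hs'

theorem extendTable_time_le {c : ℕ+} (hB : Dominates A c B) (h : Sized S E B) :
    (extendTable T c (tableOf T S E)).time ≤ B ^ 90 := by
  have h2 := hB.two_le
  have hf := fill_time_le (T := T) hB (h.extend c)
  simp only [extendTable, bind_time, accessing_val, map_val]
  refine le_pow_of_le h2 (add_le_pow h2 (accessing_time_le h2 h) (add_le_pow h2
    ((map_time_le (c := B ^ 3) fun s hs => extend_time_le hB (h.word_S s hs)).trans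
      (loop_le_pow h2 (le_pow_one h.length_S) le_rfl)) (add_le_pow h2
    ((map_time_le (c := B ^ 3) fun s hs => extend_time_le hB (h.word_E s hs)).trans
      (loop_le_pow h2 (le_pow_one h.length_E) le_rfl)) hf))) (by norm_num)

end Learner

section Learner

set_option linter.unusedSectionVars false

variable {A : Type} [Fintype A] [DecidableEq A] {k : ℕ+} {T : Teacher A} {S E : List (Word A k)}

/-! ### Rows -/

/-- The number of different rows of accessing sequences. -/
def rowCount (T : Teacher A) (S E : List (Word A k)) : ℕ := (S.map (rowOf T E)).toFinset.card

theorem rowCount_mono {S' : List (Word A k)} (h : ∀ s ∈ S, s ∈ S') :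
    rowCount T S E ≤ rowCount T S' E := by
  refine Finset.card_le_card fun r hr => ?_
  simp only [List.mem_toFinset, List.mem_map] at hr ⊢
  obtain ⟨s, hs, rfl⟩ := hr
  exact ⟨s, h s hs, rfl⟩

theorem rowCount_lt_of_new_row {v : Word A k} (h : ∀ t ∈ S, rowOf T E v ≠ rowOf T E t) :
    rowCount T S E < rowCount T (S ++ [v]) E := by
  refine Finset.card_lt_card (Finset.ssubset_iff_exists_cons_subset.2
    ⟨rowOf T E v, ?_, ?_⟩)
  · simp only [List.mem_toFinset, List.mem_map, not_exists, not_and]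
    exact fun t ht h' => h t ht h'.symm
  · intro r hr
    simp only [Finset.mem_cons, List.mem_toFinset, List.mem_map] at hr ⊢
    rcases hr with rfl | ⟨s, hs, rfl⟩
    · exact ⟨v, by simp, rfl⟩
    · exact ⟨s, by simp [hs], rfl⟩

/-- Deleting the last bit maps the new rows onto the old ones, and it identifies the new rows of `s`
and `t`, which differ. -/
theorem rowCount_lt_of_new_column {v s t : Word A k} (hs : s ∈ S) (ht : t ∈ S)
    (hst : rowOf T E s = rowOf T E t) (hne : T.member k (s ++ v) ≠ T.member k (t ++ v)) :
    rowCount T S E < rowCount T S (E ++ [v]) := by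
  have hrow : ∀ w, rowOf T (E ++ [v]) w = rowOf T E w ++ [T.member k (w ++ v)] := fun w => by
    simp [rowOf]
  have himg : (S.map (rowOf T E)).toFinset =
      (S.map (rowOf T (E ++ [v]))).toFinset.image List.dropLast := by
    ext r
    simp [hrow]
  rw [rowCount, himg]
  refine lt_of_le_of_ne Finset.card_image_le fun heq => ?_
  have hinj := Finset.card_image_iff.1 heq
  have := hinj (x₁ := rowOf T (E ++ [v]) s) (x₂ := rowOf T (E ++ [v]) t)
    (by simpa using ⟨s, hs, rfl⟩) (by simpa using ⟨t, ht, rfl⟩) (by simp [hrow, hst])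
  rw [hrow, hrow, hst] at this
  exact hne (by simpa using this)

/-- The row of `w` is a function of the state that `D` reaches on the extension of `w` to arity `κ`.
So one automaton bounds the rows of tables of all arities up to `κ`. -/
theorem rowCount_le {H : Hyperproperty A}
    (hT : ∀ (k : ℕ+) (w : Word A k), T.member k w = true ↔ unzip w ∈ bad H) {κ : ℕ+}
    (hk : k ≤ κ) {N : ℕ} {D : DFA (Fin κ → A) (Fin N)} (hD : D.accepts = badWords H κ) :
    rowCount T S E ≤ N := by
  classical
  let G : Fin N → List Bool := fun q =>
    E.map fun e => decide (D.evalFrom q (e.map (extendLetter κ)) ∈ D.accept)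
  have hG : ∀ w, rowOf T E w = G (D.eval (w.map (extendLetter κ))) := by
    intro w
    refine List.map_congr_left fun e _ => ?_
    rw [Bool.eq_iff_iff, hT, decide_eq_true_iff, ← mem_badWords, ← map_extend_mem_badWords_iff hk,
      ← hD, List.map_append, DFA.mem_accepts, DFA.eval, DFA.evalFrom_of_append]
  have hsub : (S.map (rowOf T E)).toFinset ⊆ Finset.univ.image G := by
    intro r hr
    simp only [List.mem_toFinset, List.mem_map] at hr
    obtain ⟨s, -, rfl⟩ := hr
    exact Finset.mem_image.2 ⟨_, Finset.mem_univ _, (hG s).symm⟩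
  exact (Finset.card_le_card hsub).trans (Finset.card_image_le.trans (by simp))

theorem headD_rowOf (hE : E.head? = some []) (w : Word A k) :
    (rowOf T E w).headD false = T.member k w := by
  cases E with
  | nil => simp at hE
  | cons e E =>
    obtain rfl : e = [] := by simpa using hE
    simp [rowOf]

/-! ### Conjectures -/

section Conjectures

variable {M : Conjecture A k} {σ : Fin M.size → Word A k}

theorem IsConjecture.size_le (h : IsConjecture T S E M σ) : M.size ≤ rowCount T S E := by
  have : (Finset.univ.image fun i => rowOf T E (σ i)).card = M.size := by
    rw [Finset.card_image_of_injective _ h.injective]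
    simp
  rw [← this]
  refine Finset.card_le_card fun r hr => ?_
  obtain ⟨i, -, rfl⟩ := Finset.mem_image.1 hr
  simpa using ⟨σ i, h.mem i, rfl⟩

theorem IsConjecture.accept_eq (h : IsConjecture T S E M σ) (hE : E.head? = some [])
    (i : Fin M.size) : M.accept i = T.member k (σ i) := by
  rw [h.accept, headD_rowOf hE]

theorem IsConjecture.accept_step (h : IsConjecture T S E M σ) (hE : E.head? = some [])
    (i : Fin M.size) (a : Fin k → A) : M.accept (M.step i a) = T.member k (σ i ++ [a]) := by
  rw [h.accept, h.step, headD_rowOf hE]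

/-- A conjecture is right about the accessing sequences of a larger consistent table, if all their
prefixes are accessing sequences. -/
theorem IsConjecture.row_eval (h : IsConjecture T S E M σ) {S' : List (Word A k)}
    (hS : ∀ s ∈ S, s ∈ S') (hcons : Consistent T S' E) {w : Word A k}
    (hw : ∀ v, v <+: w → v ∈ S') : rowOf T E w = rowOf T E (σ (M.toDFA.eval w)) := by
  induction w using List.reverseRecOn with
  | nil => exact h.start.symm
  | append_singleton w a ih =>
    have ih := ih fun v hv => hw v (hv.trans (List.prefix_append _ _))
    rw [hcons w (hw w (List.prefix_append _ _)) _ (hS _ (h.mem _)) ih a,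
      DFA.eval_append_singleton]
    exact (h.step _ _).symm

variable {H : Hyperproperty A}

/-- Were the amended table consistent, the conjecture would reach on `w` a state with the row of
`w`, and the first bit of that row is the right answer for `w`. -/
theorem IsConjecture.not_consistent (h : IsConjecture T S E M σ) (hE : E.head? = some [])
    (hT : ∀ (k : ℕ+) (w : Word A k), T.member k w = true ↔ unzip w ∈ bad H)
    {S' : List (Word A k)} {w : Word A k} (hS' : ∀ s, s ∈ S' ↔ s ∈ S ∨ s <+: w)
    (hw : ¬ (w ∈ M.toDFA.accepts ↔ w ∈ badWords H k)) : ¬ Consistent T S' E := by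
  intro hcons
  have hrow := h.row_eval (fun s hs => (hS' s).2 (.inl hs)) hcons
    (fun v hv => (hS' v).2 (.inr hv))
  apply hw
  rw [mem_badWords, ← hT, ← headD_rowOf (T := T) hE, hrow, ← h.accept]
  rfl

/-- Acceptance of `w` and of `w ++ [a]` agrees with badness of `σ q` and of `σ q ++ [a]`, where `q`
is the state reached on `w`. Thus the closure properties of bad words transfer to the accepted
language, although `w` and `σ q` need not have the same left quotient. -/
theorem IsConjecture.accepts_eq (h : IsConjecture T S E M σ) (hE : E.head? = some [])
    (hT : ∀ (k : ℕ+) (w : Word A k), T.member k w = true ↔ unzip w ∈ bad H)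
    (hrep : IsRepresentation H M.toDFA.accepts) (hperm : (incompleteness M).val = none) :
    M.toDFA.accepts = badWords H k := by
  have hmem : ∀ w, w ∈ M.toDFA.accepts ↔ σ (M.toDFA.eval w) ∈ badWords H k := by
    intro w
    rw [mem_badWords, ← hT, ← h.accept_eq hE]
    rfl
  have hstep : ∀ w a, w ++ [a] ∈ M.toDFA.accepts ↔
      σ (M.toDFA.eval w) ++ [a] ∈ badWords H k := by
    intro w a
    rw [mem_badWords, ← hT, ← h.accept_step hE, DFA.mem_accepts, DFA.eval_append_singleton]
    rfl
  refine hrep.eq_badWords_of_closed (fun w hw a => ?_) (fun w hw => ?_)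
    (permute_closed_of_incompleteness hperm)
  · exact (hstep w a).2 (append_mem_badWords ((hmem w).1 hw) [a])
  · obtain ⟨a, ha⟩ := exists_snoc_notMem_badWords (mt (hmem w).2 hw)
    exact ⟨a, mt (hstep w a).1 ha⟩

end Conjectures

theorem extendLetter_self (v : Fin k → A) : extendLetter k v = v := by
  funext i
  have : min (i : ℕ) (k - 1) = i := by omega
  simp [extendLetter, this]

/-- A missed bad prefix has its extension to arity `k` among the representations that are not
accepted; a spurious word has arity `k` already, where extension is the identity. -/
theorem IsCounterexample.misclassified {H : Hyperproperty A} {n : ℕ}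
    {M : DFA (Fin k → A) (Fin n)} {c : ℕ+} {w : Word A c} (h : IsCounterexample H M c w)
    (hc : c ≤ k) : ¬ (w.map (extendLetter k) ∈ M.accepts ↔
      w.map (extendLetter k) ∈ badWords H k) := by
  cases h with
  | missed _ hw h =>
    intro hiff
    exact h _ (unzip_extend hc w) (hiff.2 ((map_extend_mem_badWords_iff hc).2 hw))
  | spurious w hw h =>
    have : w.map (extendLetter k) = w := by
      rw [show (extendLetter k : (Fin k → A) → Fin k → A) = id from funext extendLetter_self,
        List.map_id]
    rw [this]
    exact fun hiff => h (hiff.1 hw)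

/-! ### One iteration -/

open Classical in
/-- A bound for the number of further iterations, for the target arity `κ` and at most `N` different
rows. -/
noncomputable def potential (T : Teacher A) (κ : ℕ+) (N : ℕ) (S E : List (Word A k)) : ℕ :=
  2 * (((κ : ℕ) - k) * (N + 1) + (N - rowCount T S E)) + if Consistent T S E then 1 else 0

/-- A new row counts two, more than the one lost if the table becomes consistent. The bound `hN`
keeps the truncated subtraction strict. -/
theorem potential_lt_of_rowCount_lt {κ : ℕ+} {N : ℕ} {S' E' : List (Word A k)}
    (h : rowCount T S E < rowCount T S' E') (hN : rowCount T S' E' ≤ N) :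
    potential T κ N S' E' < potential T κ N S E := by
  unfold potential
  split_ifs <;> omega

/-- No row disappears, and the summand for consistency drops from `1` to `0`. -/
theorem potential_lt_of_not_consistent {κ : ℕ+} {N : ℕ} {S' : List (Word A k)}
    (h : ∀ s ∈ S, s ∈ S') (hc : Consistent T S E) (hc' : ¬ Consistent T S' E) :
    potential T κ N S' E < potential T κ N S E := by
  have := rowCount_mono (T := T) (E := E) h
  unfold potential
  rw [if_pos hc, if_neg hc']
  omega

/-- A larger arity frees at least `2 * (N + 1)`, while the other summands never exceed `2 * N + 1`.
So nothing needs to be known about the rows of the new table. -/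
theorem potential_lt_of_arity_lt {κ c : ℕ+} {N : ℕ} {S' E' : List (Word A c)} (hkc : k < c)
    (hc : c ≤ κ) : potential T κ N S' E' < potential T κ N S E := by
  have h₁ : (k : ℕ) < c := hkc
  have h₂ : (c : ℕ) ≤ κ := hc
  obtain ⟨d, hd⟩ := Nat.exists_eq_add_of_lt (show (κ : ℕ) - c < κ - k by omega)
  unfold potential
  rw [hd]
  have : ((κ : ℕ) - c + d + 1) * (N + 1) = (κ - c) * (N + 1) + d * (N + 1) + (N + 1) := by ring
  split_ifs <;> omega

theorem potential_le {κ : ℕ+} {N : ℕ} : potential T κ N S E ≤ 2 * (κ * (N + 1) + N) + 1 := by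
  have : ((κ : ℕ) - k) * (N + 1) ≤ κ * (N + 1) := Nat.mul_le_mul_right _ (Nat.sub_le _ _)
  unfold potential
  split_ifs <;> omega

theorem Dominates.mono {B : ℕ} {κ : ℕ+} (h : Dominates A κ B) (hk : k ≤ κ) : Dominates A k B := by
  have hk' : (k : ℕ) ≤ κ := hk
  refine ⟨h.four_le, hk'.trans h.arity_le, le_trans ?_ h.letters_le, le_trans ?_ h.maps_le⟩
  · exact Nat.pow_le_pow_right (by omega) hk'
  · exact (Nat.pow_le_pow_left (by omega) _).trans (Nat.pow_le_pow_right (by omega) hk')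

theorem Sized.amend {X Y : ℕ} (h : Sized S E X) {S' : List (Word A k)} {w : Word A k}
    (hS' : ∀ s, s ∈ S' ↔ s ∈ S ∨ s <+: w) (hl : S'.length ≤ S.length + (w.length + 1))
    (hY : X + (w.length + 1) ≤ Y) : Sized S' E Y := by
  have := h.length_S
  have := h.length_E
  refine ⟨by omega, by omega, fun s hs => ?_, fun e he => (h.word_E e he).trans (by omega)⟩
  rcases (hS' s).1 hs with hs | hs
  · exact (h.word_S s hs).trans (by omega)
  · exact hs.length_le.trans (by omega)

end Learner

section Learner

set_option linter.unusedSectionVars false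

variable {A : Type} [Fintype A] [DecidableEq A] {k : ℕ+} {T : Teacher A} {S E : List (Word A k)}

/-- The learner can go on from the table with accessing sequences `S` and separating sequences
`E`, whose sizes are bounded by `X`. -/
structure Admissible (S E : List (Word A k)) (X : ℕ) : Prop extends Sized S E X where
  nil_mem : [] ∈ S
  head_eq : E.head? = some []

/-- What is to be shown of an iteration that starts with given potential and size: it either stops
with the automaton of all bad words, or leads to a table with smaller potential, in time bounded by
a power with exponent `p`. -/
def GoodIteration (H : Hyperproperty A) (T : Teacher A) (κ : ℕ+) (N φ X p : ℕ) :
    Timed (Outcome A) → Prop := fun x =>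
  (∃ M : Conjecture A κ, x.val = .done κ M ∧ M.toDFA.accepts = badWords H κ ∧ M.size ≤ N ∧
    ∀ B, Dominates A κ B → X + N * N + 1 ≤ B → x.time ≤ B ^ p) ∨
  ∃ (c : ℕ+) (S' E' : List (Word A c)) (l : ℕ), x.val = .next c (tableOf T S' E') l ∧ c ≤ κ ∧
    Admissible S' E' (X + l + N * N + 1) ∧ potential T κ N S' E' < φ ∧
    ∀ B, Dominates A κ B → X + l + N * N + 1 ≤ B → x.time ≤ B ^ p

variable {H : Hyperproperty A} {κ : ℕ+} {N X : ℕ}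

theorem iteration_of_inconsistency
    (hT : ∀ (k : ℕ+) (w : Word A k), T.member k w = true ↔ unzip w ∈ bad H)
    {D : DFA (Fin κ → A) (Fin N)} (hD : D.accepts = badWords H κ) (hk : k ≤ κ)
    (hO : Admissible S E X) {v : Word A k}
    (h : (inconsistency (tableOf T S E)).val = some v) :
    GoodIteration H T κ N (potential T κ N S E) X 400 (iteration T (tableOf T S E)) := by
  obtain ⟨s, hs, t, ht, a, e, he, rfl, hst, hne⟩ := exists_of_inconsistency h
  have hE := hO.length_E
  have hsz : Sized S (E ++ [a :: e]) (X + 1) := by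
    refine ⟨hO.length_S.trans (by omega), by simpa using hE,
      fun s hs => (hO.word_S s hs).trans (by omega), fun e' he' => ?_⟩
    rcases List.mem_append.1 he' with he' | he'
    · exact (hO.word_E e' he').trans (by omega)
    · rw [List.mem_singleton.1 he', List.length_cons]
      exact Nat.succ_le_succ (hO.word_E e he)
  refine .inr ⟨k, S, E ++ [a :: e], 0, ?_, hk, ⟨hsz.mono (by omega), hO.nil_mem, ?_⟩, ?_, ?_⟩
  · simp only [iteration, bind_val, h, accessing_val, snoc_val, fill_val]
    rfl
  · simp [List.head?_append, hO.head_eq]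
  · exact potential_lt_of_rowCount_lt (rowCount_lt_of_new_column hs ht hst hne)
      (rowCount_le hT hk hD)
  · intro B hB hXB
    have hB := hB.mono hk
    have h2 := hB.two_le
    have hszB := hO.toSized.mono (by omega : X ≤ B)
    have hfill := fill_time_le (T := T) hB (hsz.mono (by omega))
    simp only [iteration, bind_time, h, accessing_val, snoc_val, snoc_time, pure_time,
      add_zero]
    refine le_pow_of_le h2 (add_le_pow h2 (inconsistency_time_le hB hszB)
      (add_le_pow h2 (accessing_time_le h2 hszB) (add_le_pow h2
        (le_pow_one (by change E.length + 1 ≤ B; omega)) hfill))) (by norm_num)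

theorem iteration_of_unclosed
    (hT : ∀ (k : ℕ+) (w : Word A k), T.member k w = true ↔ unzip w ∈ bad H)
    {D : DFA (Fin κ → A) (Fin N)} (hD : D.accepts = badWords H κ) (hk : k ≤ κ)
    (hO : Admissible S E X) {v : Word A k}
    (h : (inconsistency (tableOf T S E)).val = none)
    (h' : (unclosed (tableOf T S E)).val = some v) :
    GoodIteration H T κ N (potential T κ N S E) X 400 (iteration T (tableOf T S E)) := by
  obtain ⟨s, hs, a, rfl, hne⟩ := exists_of_unclosed h'
  have hS := hO.length_S
  have hsz : Sized (S ++ [s ++ [a]]) E (X + 1) := by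
    refine ⟨by simpa using hS, hO.length_E.trans (by omega), fun s' hs' => ?_,
      fun e he => (hO.word_E e he).trans (by omega)⟩
    rcases List.mem_append.1 hs' with hs' | hs'
    · exact (hO.word_S s' hs').trans (by omega)
    · rw [List.mem_singleton.1 hs', List.length_append]
      exact Nat.succ_le_succ (hO.word_S s hs)
  refine .inr ⟨k, S ++ [s ++ [a]], E, 0, ?_, hk, ⟨hsz.mono (by omega), ?_, hO.head_eq⟩, ?_, ?_⟩
  · simp only [iteration, bind_val, h, h', accessing_val, snoc_val, fill_val]
    rfl
  · exact List.mem_append_left _ hO.nil_mem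
  · exact potential_lt_of_rowCount_lt (rowCount_lt_of_new_row hne) (rowCount_le hT hk hD)
  · intro B hB hXB
    have hB := hB.mono hk
    have h2 := hB.two_le
    have hszB := hO.toSized.mono (by omega : X ≤ B)
    have hfill := fill_time_le (T := T) hB (hsz.mono (by omega))
    simp only [iteration, bind_time, h, h', accessing_val, snoc_val, snoc_time,
      pure_time, add_zero]
    refine le_pow_of_le h2 (add_le_pow h2 (inconsistency_time_le hB hszB)
      (add_le_pow h2 (unclosed_time_le hB hszB)
      (add_le_pow h2 (accessing_time_le h2 hszB) (add_le_pow h2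
        (le_pow_one (by omega : S.length + 1 ≤ B)) hfill)))) (by norm_num)

/-- The part of an iteration that follows the construction of the conjecture `M`. -/
noncomputable def queryPart (T : Teacher A) (O : Table A k) (M : Conjecture A k) :
    Timed (Outcome A) := do
  tick (M.size * Fintype.card A ^ (k : ℕ) * (k + 1) + M.size + 1)
  match T.equiv k M.size M.toDFA with
  | some ⟨c, w⟩ =>
    tick (c * w.length + 1)
    if c ≤ k then
      let w' ← extend k w
      let O' ← amend T O w'
      return .next k O' w.length
    else
      let O₁ ← extendTable T c O
      let O₂ ← amend T O₁ w
      return .next c O₂ w.length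
  | none =>
    match ← incompleteness M with
    | some w =>
      let O' ← amend T O w
      return .next k O' 0
    | none => return .done k M

theorem iteration_of_closed {O : Table A k} (h : (inconsistency O).val = none)
    (h' : (unclosed O).val = none) :
    (iteration T O).val = (queryPart T O (conjecture O).val).val ∧
      (iteration T O).time = (inconsistency O).time + ((unclosed O).time +
        ((conjecture O).time + (queryPart T O (conjecture O).val).time)) := by
  constructor
  · simp only [iteration, bind_val, h, h']
    rfl
  · simp only [iteration, bind_time, h, h']
    rfl

theorem GoodIteration.of_closed (hO : Admissible S E X) (hk : k ≤ κ) {φ : ℕ}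
    (h : (inconsistency (tableOf T S E)).val = none)
    (h' : (unclosed (tableOf T S E)).val = none)
    (hg : GoodIteration H T κ N φ X 290
      (queryPart T (tableOf T S E) (conjecture (tableOf T S E)).val)) :
    GoodIteration H T κ N φ X 400 (iteration T (tableOf T S E)) := by
  obtain ⟨hv, ht⟩ := iteration_of_closed (T := T) h h'
  have htime : ∀ B, Dominates A κ B → X ≤ B → (queryPart T (tableOf T S E)
      (conjecture (tableOf T S E)).val).time ≤ B ^ 290 →
      (iteration T (tableOf T S E)).time ≤ B ^ 400 := by
    intro B hB hXB hq
    have hB := hB.mono hk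
    have h2 := hB.two_le
    have hszB := hO.toSized.mono hXB
    rw [ht]
    exact le_pow_of_le h2 (add_le_pow h2 (inconsistency_time_le hB hszB)
      (add_le_pow h2 (unclosed_time_le hB hszB)
      (add_le_pow h2 (conjecture_time_le hB hszB hO.nil_mem) hq))) (by norm_num)
  rcases hg with ⟨M, h₁, h₂, h₃, h₄⟩ | ⟨c, S', E', l, h₁, h₂, h₃, h₄, h₅⟩
  · exact .inl ⟨M, hv.trans h₁, h₂, h₃, fun B hB hXB =>
      htime B hB (by omega) (h₄ B hB hXB)⟩
  · exact .inr ⟨c, S', E', l, hv.trans h₁, h₂, h₃, h₄, fun B hB hXB =>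
      htime B hB (by omega) (h₅ B hB hXB)⟩

theorem query_time_le {B : ℕ} (hB : Dominates A k B) {n : ℕ} (hn : n ≤ B) :
    n * Fintype.card A ^ (k : ℕ) * (k + 1) + n + 1 ≤ B ^ 7 := by
  have h2 := hB.two_le
  have hA : Fintype.card A ^ (k : ℕ) ≤ B ^ 1 := by
    rw [pow_one, ← length_letters]
    exact length_letters_le hB.letters_le
  exact le_pow_of_le h2 (add_le_pow h2 (add_le_pow h2 (mul_le_pow (mul_le_pow (le_pow_one hn) hA)
    (add_le_pow h2 (le_pow_one hB.arity_le) one_le_pow_zero)) (le_pow_one hn)) one_le_pow_zero)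
    (by norm_num)

theorem goodIteration (hT : MinimalAdequate H T) (hκ : IsTargetArity H κ)
    {D : DFA (Fin κ → A) (Fin N)} (hD : D.accepts = badWords H κ) (hk : k ≤ κ)
    (hO : Admissible S E X) :
    GoodIteration H T κ N (potential T κ N S E) X 400 (iteration T (tableOf T S E)) := by
  have hm := hT.member_iff
  rcases h : (inconsistency (tableOf T S E)).val with _ | v
  swap
  · exact iteration_of_inconsistency hm hD hk hO h
  rcases h' : (unclosed (tableOf T S E)).val with _ | v
  swap
  · exact iteration_of_unclosed hm hD hk hO h h'
  refine GoodIteration.of_closed hO hk h h' ?_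
  have hcons := consistent_of_inconsistency h
  obtain ⟨σ, hσ⟩ := exists_isConjecture hO.nil_mem (closed_of_unclosed h')
  generalize (conjecture (tableOf T S E)).val = M at σ hσ
  have hMN : M.size ≤ N := hσ.size_le.trans (rowCount_le hm hk hD)
  have hNN : N ≤ N * N := Nat.le_mul_self N
  rcases hq : T.equiv k M.size M.toDFA with _ | ⟨c, w⟩
  · have hrep := (hT.equiv_none_iff κ hκ k M.size M.toDFA hk).1 hq
    have hreg : M.toDFA.accepts.IsRegular := ⟨_, inferInstance, M.toDFA, rfl⟩
    -- A correct "yes" exhibits a bad-prefix automaton of arity `k`, so `k` is not below the target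
    -- arity.
    obtain rfl : k = κ := by
      rcases lt_or_eq_of_le hk with hlt | rfl
      · exact absurd ⟨_, hreg, hrep⟩ (hκ.2 k hlt)
      · rfl
    rcases hi : (incompleteness M).val with _ | w
    · refine .inl ⟨M, ?_, hσ.accepts_eq hO.head_eq hm hrep hi, hMN, fun B hB hXB => ?_⟩
      · simp only [queryPart, bind_val, hq, hi]
        rfl
      · have h2 := hB.two_le
        have hMB : M.size ≤ B := by omega
        simp only [queryPart, bind_time, tick_time, hq, hi, pure_time, add_zero]
        exact le_pow_of_le h2 (add_le_pow h2 (query_time_le hB hMB)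
          (incompleteness_time_le hB.four_le hB.arity_le hB.letters_le hB.maps_le hMB))
          (by norm_num)
    · obtain ⟨f, hf, hw, hlen⟩ := exists_of_incompleteness hi
      -- Source of `N * N` in the size bounds: the search visits words no longer than its number of
      -- rounds.
      have hlen' : w.length ≤ N * N := hlen.trans (Nat.mul_le_mul hMN hMN)
      obtain ⟨S', hv, hS', hl⟩ := amend_spec (T := T) (S := S) (E := E) w
      refine .inr ⟨k, S', E, 0, ?_, le_rfl, ⟨hO.toSized.amend hS' hl (by omega),
        (hS' _).2 (.inl hO.nil_mem), hO.head_eq⟩, ?_, fun B hB hXB => ?_⟩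
      · simp only [queryPart, bind_val, hq, hi, hv]
        rfl
      · refine potential_lt_of_not_consistent (fun s hs => (hS' s).2 (.inl hs)) hcons
          (hσ.not_consistent hO.head_eq hm hS' fun hiff => hw (hiff.2 ?_))
        -- The accepted word `permute f w` represents a bad subset of `unzip w`; hence the rejected
        -- `w` is bad as well and is misclassified.
        exact bad_mono (unzip_permute_subset f w) (hrep.1 _ hf)
      · have h2 := hB.two_le
        have hMB : M.size ≤ B := by omega
        have := hO.length_S
        simp only [queryPart, bind_time, tick_time, hq, hi, pure_time, add_zero]
        exact le_pow_of_le h2 (add_le_pow h2 (query_time_le hB hMB) (add_le_pow h2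
          (incompleteness_time_le hB.four_le hB.arity_le hB.letters_le hB.maps_le hMB)
          (amend_time_le hB (hO.toSized.mono (by omega)) (by omega)))) (by norm_num)
  · obtain ⟨hcex, hcκ, -⟩ := hT.equiv_some κ hκ k M.size M.toDFA hk c w hq
    by_cases hck : c ≤ k
    · have hwl : (w.map (extendLetter k) : Word A k).length = w.length := by simp
      obtain ⟨S', hv, hS', hl⟩ := amend_spec (T := T) (S := S) (E := E) (w.map (extendLetter k))
      refine .inr ⟨k, S', E, w.length, ?_, hk, ⟨hO.toSized.amend hS' hl (by omega),
        (hS' _).2 (.inl hO.nil_mem), hO.head_eq⟩, ?_, fun B hB hXB => ?_⟩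
      · simp only [queryPart, bind_val, hq, if_pos hck]
        rw [← hv]
        rfl
      · exact potential_lt_of_not_consistent (fun s hs => (hS' s).2 (.inl hs)) hcons
          (hσ.not_consistent hO.head_eq hm hS' (hcex.misclassified hck))
      · have hc := (hB.mono hcκ).arity_le
        have hB := hB.mono hk
        have h2 := hB.two_le
        have hMB : M.size ≤ B := by omega
        have hwB : w.length ≤ B := by omega
        have := hO.length_S
        have ha := amend_time_le (T := T) hB (hO.toSized.mono (by omega))
          (w := w.map (extendLetter k)) (by omega)
        simp only [queryPart, bind_time, tick_time, hq, if_pos hck, pure_time, add_zero]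
        exact le_pow_of_le h2 (add_le_pow h2 (query_time_le hB hMB) (add_le_pow h2
          (add_le_pow h2 (mul_le_pow (le_pow_one hc) (le_pow_one hwB)) one_le_pow_zero)
          (add_le_pow h2 (extend_time_le hB hwB) ha))) (by norm_num)
    · have hsz := hO.toSized.extend c
      obtain ⟨S', hv, hS', hl⟩ := amend_spec (T := T) (S := S.map fun s => s.map (extendLetter c))
        (E := E.map fun e => e.map (extendLetter c)) w
      refine .inr ⟨c, S', E.map fun e => e.map (extendLetter c), w.length, ?_, hcκ,
        ⟨hsz.amend hS' hl (by omega), (hS' _).2 (.inl ?_), ?_⟩,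
        potential_lt_of_arity_lt (not_le.1 hck) hcκ, fun B hB hXB => ?_⟩
      · simp only [queryPart, bind_val, hq, if_neg hck]
        rw [extendTable_val, hv]
        rfl
      · exact List.mem_map.2 ⟨[], hO.nil_mem, rfl⟩
      · simp [hO.head_eq]
      · have hBc := hB.mono hcκ
        have hB := hB.mono hk
        have h2 := hB.two_le
        have hMB : M.size ≤ B := by omega
        have hwB : w.length ≤ B := by omega
        have := hsz.length_S
        have ha := amend_time_le (T := T) hBc (hsz.mono (by omega)) (w := w) (by omega)
        simp only [queryPart, bind_time, tick_time, hq, if_neg hck, pure_time, add_zero]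
        rw [extendTable_val]
        exact le_pow_of_le h2 (add_le_pow h2 (query_time_le hB hMB) (add_le_pow h2
          (add_le_pow h2 (mul_le_pow (le_pow_one hBc.arity_le) (le_pow_one hwB)) one_le_pow_zero)
          (add_le_pow h2 (extendTable_time_le hBc (hO.toSized.mono (by omega))) ha)))
          (by norm_num)

end Learner

section Learner

set_option linter.unusedSectionVars false

variable {A : Type} [Fintype A] [DecidableEq A] {T : Teacher A}
  {H : Hyperproperty A} {κ : ℕ+} {N : ℕ}

/-! ### Complete runs -/

/-- Induction on a bound for the potential. The length `m` is known only when the run is over, so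
the time is bounded for every base that is large enough for the final `m`. -/
theorem exists_runs (hT : MinimalAdequate H T) (hκ : IsTargetArity H κ)
    {D : DFA (Fin κ → A) (Fin N)} (hD : D.accepts = badWords H κ) (n : ℕ) {k : ℕ+} (hk : k ≤ κ)
    {S E : List (Word A k)} {X : ℕ} (hO : Admissible S E X) (hn : potential T κ N S E ≤ n) :
    ∃ (M : Conjecture A κ) (t m : ℕ), Runs T M (tableOf T S E) t m ∧
      M.toDFA.accepts = badWords H κ ∧ M.size ≤ N ∧
        ∀ B, Dominates A κ B → X + (n + 1) * (m + N * N + 1) ≤ B → t ≤ (n + 1) * B ^ 400 := by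
  induction n generalizing k S E X with
  | zero =>
    rcases goodIteration hT hκ hD hk hO with ⟨M, h₁, h₂, h₃, h₄⟩ | ⟨c, S', E', l, -, -, -, h, -⟩
    · exact ⟨M, _, 0, .done _ h₁, h₂, h₃, fun B hB hX => by
        rw [zero_add, one_mul]
        exact h₄ B hB (by omega)⟩
    · omega
  | succ n ih =>
    rcases goodIteration hT hκ hD hk hO with ⟨M, h₁, h₂, h₃, h₄⟩ |
      ⟨c, S', E', l, h₁, hc, hO', hφ, h₄⟩
    · refine ⟨M, _, 0, .done _ h₁, h₂, h₃, fun B hB hX => ?_⟩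
      have := Nat.le_mul_of_pos_left (0 + N * N + 1) (show 0 < n + 1 + 1 by omega)
      exact (h₄ B hB (by omega)).trans (Nat.le_mul_of_pos_left _ (by omega))
    · obtain ⟨M, t, m, hr, hM, hMN, ht⟩ := ih hc hO' (by omega)
      refine ⟨M, _, _, .next _ _ l t m h₁ hr, hM, hMN, fun B hB hX => ?_⟩
      -- The first iteration enlarges the table by `l + N * N + 1`, the others by at most `m + N * N
      -- + 1` each; both are covered by `max l m`.
      have hle : X + (l + N * N + 1) + (n + 1) * (m + N * N + 1) ≤
          X + (n + 1 + 1) * (max l m + N * N + 1) := by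
        have h₅ : (n + 1) * (m + N * N + 1) ≤ (n + 1) * (max l m + N * N + 1) :=
          Nat.mul_le_mul_left _ (by omega)
        have h₆ : l ≤ max l m := le_max_left _ _
        rw [add_mul (n + 1) 1, one_mul]
        omega
      have h₅ := h₄ B hB (by omega)
      have h₆ := ht B hB (by omega)
      rw [add_mul (n + 1) 1, one_mul]
      omega

theorem two_pow_le_add_one_pow (κ : ℕ+) : 2 ^ (κ : ℕ) ≤ ((κ : ℕ) + 1) ^ (κ : ℕ) :=
  Nat.pow_le_pow_left (by have := κ.pos; omega) _

/-- A common base for the time bounds of the learner. -/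
theorem dominates_base {z P : ℕ} (hz : 1 ≤ z) (hP : P = ((κ : ℕ) + 1) ^ (κ : ℕ)) :
    Dominates A κ (z ^ 3 * P ^ (Fintype.card A + 7)) := by
  have hκ := κ.pos
  have h2P : 2 ^ (κ : ℕ) ≤ P := hP ▸ two_pow_le_add_one_pow κ
  have hP2 : 2 ≤ P := (Nat.le_self_pow hκ.ne' 2).trans h2P
  have hz3 : 1 ≤ z ^ 3 := Nat.one_le_pow _ _ hz
  have hle : ∀ {j x}, x ≤ P ^ j → j ≤ Fintype.card A + 7 →
      x ≤ z ^ 3 * P ^ (Fintype.card A + 7) := fun hx hj =>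
    (hx.trans (Nat.pow_le_pow_right (by omega) hj)).trans (Nat.le_mul_of_pos_left _ hz3)
  refine ⟨hle (j := 2) ?_ (by omega), hle (j := 1) ?_ (by omega), hle (j := Fintype.card A + 1) ?_
    (by omega), hle (j := 1) ?_ (by omega)⟩
  · nlinarith
  · rw [pow_one]
    exact (Nat.lt_two_pow_self (n := (κ : ℕ))).le.trans h2P
  -- The alphabet is absorbed into the exponent through `x ≤ 2 ^ x` and `2 ^ κ ≤ P`.
  · calc (Fintype.card A + 1) ^ (κ : ℕ) ≤ (2 ^ (Fintype.card A + 1)) ^ (κ : ℕ) :=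
          Nat.pow_le_pow_left Nat.lt_two_pow_self.le _
      _ = (2 ^ (κ : ℕ)) ^ (Fintype.card A + 1) := by rw [← pow_mul, ← pow_mul, mul_comm]
      _ ≤ P ^ (Fintype.card A + 1) := Nat.pow_le_pow_left h2P _
  · rw [pow_one, hP]

theorem exists_learns (hT : MinimalAdequate H T) (hκ : IsTargetArity H κ)
    {D : DFA (Fin κ → A) (Fin N)} (hD : D.accepts = badWords H κ) :
    ∃ (M : Conjecture A κ) (t m : ℕ), Learns T M t m ∧ M.toDFA.accepts = badWords H κ ∧
      M.size ≤ N ∧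
        t ≤ (N + m) ^ 1206 * (((κ : ℕ) + 1) ^ (κ : ℕ)) ^ ((Fintype.card A + 7) * 402) := by
  have hO : Admissible (A := A) (k := 1) [[]] [[]] 1 :=
    ⟨⟨le_rfl, le_rfl, fun s hs => by rw [List.mem_singleton.1 hs]; exact Nat.zero_le _,
      fun s hs => by rw [List.mem_singleton.1 hs]; exact Nat.zero_le _⟩,
      List.mem_singleton_self _, rfl⟩
  obtain ⟨M, t, m, hr, hM, hMN, ht⟩ := exists_runs hT hκ hD _ one_le hO potential_le
  refine ⟨M, _, m, ⟨t, rfl, by rwa [fill_val]⟩, hM, hMN, ?_⟩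
  have hN : 1 ≤ N := (Nat.le_add_left 1 M.last).trans hMN
  set z := N + m with hz
  set P := ((κ : ℕ) + 1) ^ (κ : ℕ) with hP
  have hB := dominates_base (A := A) (by omega : 1 ≤ z) hP
  set B := z ^ 3 * P ^ (Fintype.card A + 7) with hBdef
  have h2 := hB.two_le
  have hκ0 := κ.pos
  have hκP : (κ : ℕ) ≤ P :=
    (Nat.lt_two_pow_self (n := (κ : ℕ))).le.trans (two_pow_le_add_one_pow κ)
  have hP2 : 2 ≤ P := (Nat.le_self_pow hκ0.ne' 2).trans (two_pow_le_add_one_pow κ)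
  have hz1 : 1 ≤ z := by omega
  have hiter : 2 * (κ * (N + 1) + N) + 1 + 1 ≤ 8 * (z * P) := by
    have h₁ : (κ : ℕ) * (N + 1) ≤ P * (2 * z) := Nat.mul_le_mul hκP (by omega)
    have h₂ : 2 * z ≤ P * z := Nat.mul_le_mul_right _ hP2
    nlinarith
  have hcex : m + N * N + 1 ≤ 3 * z ^ 2 := by
    have h₁ : N * N ≤ z * z := Nat.mul_le_mul (by omega) (by omega)
    have h₂ : z ≤ z * z := Nat.le_mul_self z
    nlinarith
  have hPB : z ^ 3 * P ^ 7 ≤ B :=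
    Nat.mul_le_mul_left _ (Nat.pow_le_pow_right (by omega) (by omega))
  have hconst : 32 ≤ P ^ 6 :=
    le_trans (by norm_num : 32 ≤ 2 ^ 6) (Nat.pow_le_pow_left hP2 6)
  have hmain : 32 * (z ^ 3 * P) ≤ B := by
    refine le_trans ?_ hPB
    calc 32 * (z ^ 3 * P) ≤ P ^ 6 * (z ^ 3 * P) := Nat.mul_le_mul_right _ hconst
      _ = z ^ 3 * P ^ 7 := by ring
  have hzP : 1 ≤ z ^ 3 * P := Nat.mul_pos (Nat.pow_pos hz1) (by omega)
  -- Iterations times growth per iteration give `24 * (z ^ 3 * P)`, which explains the exponent `3`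
  -- of `z`; the factor `32` leaves room for the initial size `1`.
  have hX : 1 + (2 * (κ * (N + 1) + N) + 1 + 1) * (m + N * N + 1) ≤ B := by
    have h₁ := Nat.mul_le_mul hiter hcex
    have h₂ : 8 * (z * P) * (3 * z ^ 2) = 24 * (z ^ 3 * P) := by ring
    omega
  have hiterB : 2 * (κ * (N + 1) + N) + 1 + 1 ≤ B ^ 1 := by
    rw [pow_one]
    have h₁ : z * P ≤ z ^ 3 * P := Nat.mul_le_mul_right _ (Nat.le_self_pow (by norm_num) z)
    omega
  have hfill := fill_time_le (T := T) (hB.mono one_le) (hO.toSized.mono (by omega))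
  have htB := (ht B hB hX).trans (mul_le_pow hiterB le_rfl)
  have hfill' : (fill T (k := 1) [[]] [[]]).time ≤ B ^ (1 + 400) :=
    le_pow_of_le h2 hfill (by norm_num)
  -- The first table and all iterations each cost at most `B ^ 401`, together at most `B ^ 402`; the
  -- exponent `1206` is `3 * 402`.
  calc (fill T (k := 1) [[]] [[]]).time + t ≤ B ^ (1 + 400) * 2 := by omega
    _ ≤ B ^ (1 + 400) * B := Nat.mul_le_mul_left _ h2
    _ = z ^ 1206 * P ^ ((Fintype.card A + 7) * 402) := by
      rw [← pow_succ, hBdef, mul_pow, ← pow_mul, ← pow_mul]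

theorem exists_minimal_dfa {α : Type} {L : Language α} (h : L.IsRegular) :
    ∃ (N : ℕ) (D : DFA α (Fin N)), D.accepts = L ∧
      ∀ (n : ℕ) (M : DFA α (Fin n)), M.accepts = L → N ≤ n := by
  classical
  have hex : ∃ (N : ℕ) (D : DFA α (Fin N)), D.accepts = L := by
    obtain ⟨σ, _, D, hD⟩ := h
    exact ⟨_, DFA.reindex (Fintype.equivFin σ) D, by rw [DFA.accepts_reindex, hD]⟩
  obtain ⟨D, hD⟩ := Nat.find_spec hex
  exact ⟨_, D, hD, fun n M hM => Nat.find_min' hex ⟨M, hM⟩⟩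

end Learner

end HyperLearn

theorem mainTheorem6 (A : Type) [Fintype A] [DecidableEq A] :
    ∃ C : ℕ, ∀ (S : Hyperproperty A) (k₀ : ℕ+), IsKSafety S k₀ → IsRegularHyper S →
      ∀ T : Teacher A, MinimalAdequate S T →
        ∃ (k : ℕ+) (M : Conjecture A k) (t m : ℕ),
          Learns T M t m ∧ IsMinimalBPA S M.toDFA ∧ k ≤ k₀ ∧
            t ≤ C * (M.size + m) ^ C * ((k : ℕ) + 1) ^ (C * (k : ℕ)) := by
  refine ⟨(Fintype.card A + 7) * 402, fun S k₀ hsafe hreg T hT => ?_⟩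
  obtain ⟨κ, hκ⟩ := hreg.exists_isTargetArity
  obtain ⟨L, hL, hrep⟩ := hκ.1
  obtain ⟨N, D, hD, hmin⟩ := exists_minimal_dfa (hrep.isRegular_badWords hL κ)
  obtain ⟨M, t, m, hlearn, hM, hMN, ht⟩ := exists_learns hT hκ hD
  -- The learner never makes more states than there are rows, hence at most `N`, and `N` is the
  -- least number for this language.
  obtain rfl : M.size = N := le_antisymm hMN (hmin _ M.toDFA hM)
  refine ⟨κ, M, t, m, hlearn, ?_, ?_, ?_⟩
  · refine ⟨⟨?_, ?_, ?_⟩, hκ.2, fun n' M' hM' => hmin _ M' ?_⟩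
    · rw [hM]; exact hrep.badWords
    · rw [hM]; exact isTight_badWords hrep.empty_mem
    · rw [hM]; exact isPermComplete_badWords
    · exact eq_badWords hM'.representation hM'.tight hM'.permComplete
  -- Safety makes the regular language `badWords S k₀` a representation, so the least arity cannot
  -- exceed `k₀`.
  · by_contra hlt
    exact hκ.2 k₀ (not_le.1 hlt) ⟨_, hrep.isRegular_badWords hL k₀,
      hsafe.isRepresentation_badWords hrep.empty_mem⟩
  · refine ht.trans (Nat.mul_le_mul ?_ (le_of_eq ?_))
    -- The exponent `1206 = 3 * 402` is at most `C = (Fintype.card A + 7) * 402`.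
    · refine le_trans (pow_le_pow_right₀ ?_ ?_) (Nat.le_mul_of_pos_left _ (by positivity))
      · exact (Nat.le_add_left 1 M.last).trans (Nat.le_add_right _ m)
      · exact Nat.mul_le_mul_right 402 ((by norm_num : 3 ≤ 7).trans (Nat.le_add_left 7 _))
    · rw [← pow_mul, mul_comm]
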